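/- Let $G$ be a simple undirected graph on the vertex set $[n]$, $n\ge 2$, let $r\in[n]$ be a root (for instance $r=1$), and let $\widetilde G$ be the directed graph that contains both $(u,v)$ and $(v,u)$ for every edge $\{u,v\}$ of $G$. The directed spanning tree polynomial of $\widetilde G$ is $$\mathrm{ST}_n(\widetilde G)=\sum_{\nu\in T_n}\ \prod_{i\in[n]\setminus\{r\}}x_{i,\nu(i)}\in\mathbb{R}[x_{i,j}: i,j\in[n]],$$ where $T_n$ is the set of maps $\nu:[n]\setminus\{r\}\to[n]$ such that $(i,\nu(i))\in E(\widetilde G)$ for every $i$, and for every $i$ there is a $k$ with $\nu^k(i)=r$. A monotone arithmetic circuit is an arithmetic circuit with addition and multiplication gates (of arbitrary fan-in) whose inputs are variables and nonnegative real constants; its size is the number of addition and multiplication gates. (1) There is an absolute constant $c>0$ such that for every $\epsilon>0$ there is a $d_0$ with the following property. Let $d\ge d_0$, and let $G$ be a $d$-regular graph on $n\ge 2$ vertices whose adjacency matrix has second largest eigenvalue (counted with multiplicity) $\lambda_2\le d^{1-\epsilon}$. Then every monotone arithmetic circuit that computes $\mathrm{ST}_n(\widetilde G)$ has size at least $2^{cn}$.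 Here $\mathrm{ST}_n(\widetilde G)$ depends on at most $dn$ variables, so for constant $d$ this lower bound is strongly exponential. (2) For every sequence of graphs $G_n$ on $n$ vertices ($n\ge 1$) and every choice of roots, the polynomials $\mathrm{ST}_n(\widetilde{G_n})$ form a family in $\mathrm{VP}$: the number of variables, the degree, and the size of suitable arithmetic circuits of fan-in two over $\mathbb{R}$ (with negative constants allowed) are bounded by a polynomial in $n$. -/

import Mathlib

/-! ### Arithmetic circuits over the reals -/

/-- An input wire of a gate: a variable, a real constant, or one of the `k` earlier gates. -/
inductive Operand (σ : Type) (k : ℕ) : Type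
  | var (x : σ) : Operand σ k
  | const (c : ℝ) : Operand σ k
  | gate (j : Fin k) : Operand σ k

/-- An addition or multiplication gate of arbitrary fan-in `m`, with access to `k` earlier gates. -/
inductive Gate (σ : Type) (k : ℕ) : Type
  | add (m : ℕ) (a : Fin m → Operand σ k) : Gate σ k
  | mul (m : ℕ) (a : Fin m → Operand σ k) : Gate σ k

/-- An arithmetic circuit (a directed acyclic graph) with its addition and multiplication gates
listed in topological order. Variables and constants are used as free inputs. `size` is the number
of addition and multiplication gates. -/
structure Circuit (σ : Type) : Type where
  size : ℕ
  gate : (i : Fin size) → Gate σ i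
  output : Operand σ size

namespace Operand

/-- The polynomial carried by a wire, given the polynomials `v` computed at the earlier gates. -/
noncomputable def eval {σ : Type} {k : ℕ} (v : Fin k → MvPolynomial σ ℝ) :
    Operand σ k → MvPolynomial σ ℝ
  | var x => MvPolynomial.X x
  | const c => MvPolynomial.C c
  | gate j => v j

/-- Constants are nonnegative. -/
def IsMonotone {σ : Type} {k : ℕ} : Operand σ k → Prop
  | var _ => True
  | const c => 0 ≤ c
  | gate _ => True

end Operand

namespace Gate

/-- The polynomial computed by a gate, given the polynomials `v` computed at the earlier gates. -/
noncomputable def eval {σ : Type} {k : ℕ} (v : Fin k → MvPolynomial σ ℝ) :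
    Gate σ k → MvPolynomial σ ℝ
  | add _ a => ∑ j, (a j).eval v
  | mul _ a => ∏ j, (a j).eval v

/-- All constants feeding into the gate are nonnegative. -/
def IsMonotone {σ : Type} {k : ℕ} : Gate σ k → Prop
  | add _ a => ∀ j, (a j).IsMonotone
  | mul _ a => ∀ j, (a j).IsMonotone

/-- The number of input wires of the gate. -/
def fanin {σ : Type} {k : ℕ} : Gate σ k → ℕ
  | add m _ => m
  | mul m _ => m

end Gate

namespace Circuit

/-- The polynomial computed at the gate `i`. -/
noncomputable def value {σ : Type} (C : Circuit σ) (i : Fin C.size) : MvPolynomial σ ℝ :=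
  (C.gate i).eval (fun j : Fin i => C.value ⟨j, j.2.trans i.2⟩)
termination_by i.val
decreasing_by exact j.2

/-- The circuit `C` computes the polynomial `p`. -/
def Computes {σ : Type} (C : Circuit σ) (p : MvPolynomial σ ℝ) : Prop :=
  C.output.eval C.value = p

/-- A monotone circuit: no negative constants (and there are no subtraction gates). -/
def IsMonotone {σ : Type} (C : Circuit σ) : Prop :=
  (∀ i, (C.gate i).IsMonotone) ∧ C.output.IsMonotone

/-- Every gate has at most two inputs. -/
def FaninTwo {σ : Type} (C : Circuit σ) : Prop :=
  ∀ i, (C.gate i).fanin ≤ 2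

end Circuit

/-- A family of real polynomials is in the class VP: the number of variables, the degree, and the
size of a suitable arithmetic circuit of fan-in two (which may use negative constants) are bounded
by a polynomial in the index. -/
def InVP {σ : ℕ → Type} (f : ∀ n, MvPolynomial (σ n) ℝ) : Prop :=
  ∃ p : Polynomial ℕ, ∀ n : ℕ,
    (f n).vars.card ≤ p.eval n ∧
    (f n).totalDegree ≤ p.eval n ∧
    ∃ C : Circuit (σ n), C.FaninTwo ∧ C.Computes (f n) ∧ C.size ≤ p.eval n

/-! ### The directed spanning tree polynomial -/

/-- `ν` (an out-edge `(i, ν i)` for every vertex `i` other than the root `r`), extended to all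
vertices by letting it stay at the root. -/
def extendRoot {V : Type} [DecidableEq V] (r : V) (ν : {v : V // v ≠ r} → V) (v : V) : V :=
  if h : v = r then r else ν ⟨v, h⟩

/-- `ν` describes a spanning tree of the bidirected version of `G`, directed towards the root `r`:
every `(i, ν i)` is an edge, and iterating `ν` leads from every vertex to the root. -/
def IsDirectedSpanningTree {V : Type} [DecidableEq V] (G : SimpleGraph V) (r : V)
    (ν : {v : V // v ≠ r} → V) : Prop :=
  (∀ i : {v : V // v ≠ r}, ∃ k : ℕ, (extendRoot r ν)^[k] i.1 = r) ∧
    ∀ i : {v : V // v ≠ r}, G.Adj i.1 (ν i)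

open Classical in
/-- The directed spanning tree polynomial of the bidirected version of `G` with root `r`. -/
noncomputable def spanningTreePoly {V : Type} [Fintype V] [DecidableEq V]
    (G : SimpleGraph V) (r : V) : MvPolynomial (V × V) ℝ :=
  ∑ ν : {v : V // v ≠ r} → V with IsDirectedSpanningTree G r ν,
    ∏ i : {v : V // v ≠ r}, MvPolynomial.X (i.1, ν i)

/-! ### The second eigenvalue -/

theorem adjMatrix_isHermitian {V : Type} (G : SimpleGraph V) [DecidableRel G.Adj] :
    (G.adjMatrix ℝ).IsHermitian := by
  rw [Matrix.IsHermitian, Matrix.conjTranspose_eq_transpose_of_trivial]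
  exact G.isSymm_adjMatrix

/-- The second largest eigenvalue (counted with multiplicity) of the adjacency matrix. -/
noncomputable def secondEigenvalue {V : Type} [Fintype V] [DecidableEq V] (G : SimpleGraph V)
    [DecidableRel G.Adj] (hV : 1 < Fintype.card V) : ℝ :=
  (adjMatrix_isHermitian G).eigenvalues₀ ⟨1, hV⟩

/-! Upper bound: by the directed matrix-tree theorem (`det_reducedLaplacian`) the polynomial is a
determinant with entries linear in the variables. Powers of the matrix, their traces and Newton's
identities (`Matrix.newton_charpoly`) give a division-free-in-variables circuit with polynomially
many gates; only divisions by positive integers occur, and these are real constants.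

Lower bound: without negative constants nothing cancels, so supports of sums and products are unions
and sumsets. Following a monomial down the circuit to the gate where a factor of degree between `D`
and `2 * D` splits off covers all spanning trees by one balanced "rectangle" per gate
(`Circuit.IsMonotone.exists_rectangles`). Each row other than the root's occurs exactly once in a
tree monomial, so a rectangle fixes a vertex set `S` such that the out-arcs on `S` of one tree may
be combined with the out-arcs off `S` of another (`mixesAlong_of_rectangle`).

Such a family is small. If an edge `{i, j}` crosses `S` and avoids the root, the family cannot use
both `(i, j)` and `(j, i)`, since a recombination would contain a 2-cycle. Hence almost one arc per
cut edge is lost, and with `e` cut edges the family has at most `d ^ (n - 1) * exp (1 - e / d)`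
trees (`ncard_le_of_mixesAlong`). The spectral gap gives `e / d ≥ 3 * n / 32` for balanced `S`.

In total there are many trees: at least `d ^ (n - 1) * exp (-2 * n / d) / n` (`treeCount_ge`),
because the eigenvalues of the Laplacian, shifted by a rank one matrix, are concentrated near `d`.
Comparing the two counts bounds the number of gates. The eigenvalue hypothesis enters only as `λ₂ ≤
d / 2`. -/

/-! ### The directed matrix-tree theorem -/

section MatrixTree

variable {V : Type} [DecidableEq V] {R : Type*} [CommRing R]

/-- The zero-one matrix of the map `ν`, restricted to the vertices other than the root. -/
def stepMatrix (R : Type*) [CommRing R] (r : V) (ν : {v : V // v ≠ r} → V) :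
    Matrix {v : V // v ≠ r} {v : V // v ≠ r} R :=
  Matrix.of fun i j => if ν i = j.1 then 1 else 0

theorem extendRoot_root (r : V) (ν : {v : V // v ≠ r} → V) : extendRoot r ν r = r := by
  simp [extendRoot]

theorem extendRoot_coe (r : V) (ν : {v : V // v ≠ r} → V) (i : {v : V // v ≠ r}) :
    extendRoot r ν i = ν i := by
  simp [extendRoot, i.2]

theorem iterate_extendRoot_root (r : V) (ν : {v : V // v ≠ r} → V) (k : ℕ) :
    (extendRoot r ν)^[k] r = r :=
  Function.iterate_fixed (extendRoot_root r ν) k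

variable [Fintype V]

/-- The root has no row or column, so a walk that reaches it disappears from the powers. This is
what makes the matrix of a tree nilpotent. -/
theorem stepMatrix_pow_apply (r : V) (ν : {v : V // v ≠ r} → V) (k : ℕ)
    (i j : {v : V // v ≠ r}) :
    (stepMatrix R r ν ^ k) i j = if (extendRoot r ν)^[k] i.1 = j.1 then 1 else 0 := by
  induction k generalizing i with
  | zero =>
    rw [pow_zero, Function.iterate_zero, id, Matrix.one_apply]
    exact if_congr Subtype.ext_iff rfl rfl
  | succ k ih =>
    rw [pow_succ', Matrix.mul_apply, Function.iterate_succ_apply, extendRoot_coe]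
    by_cases h : ν i = r
    · rw [h, iterate_extendRoot_root, if_neg (Ne.symm j.2)]
      refine Finset.sum_eq_zero fun l _ => ?_
      simp [stepMatrix, h, Ne.symm l.2]
    · rw [Finset.sum_eq_single ⟨ν i, h⟩]
      · rw [ih]
        simp [stepMatrix]
      · intro l _ hl
        have : ν i ≠ l.1 := fun h' => hl (Subtype.ext h'.symm)
        simp [stepMatrix, this]
      · simp

theorem isNilpotent_stepMatrix (r : V) (ν : {v : V // v ≠ r} → V)
    (h : ∀ i : {v : V // v ≠ r}, ∃ k : ℕ, (extendRoot r ν)^[k] i.1 = r) :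
    IsNilpotent (stepMatrix R r ν) := by
  choose k hk using h
  -- The sum is a common bound for all hitting times, and the root is a fixed point.
  refine ⟨∑ i, k i, ?_⟩
  ext i j
  obtain ⟨m, hm⟩ := Nat.exists_eq_add_of_le' (Finset.single_le_sum (f := k)
    (fun _ _ => Nat.zero_le _) (Finset.mem_univ i))
  rw [stepMatrix_pow_apply, hm, Function.iterate_add_apply, hk, iterate_extendRoot_root,
    if_neg (Ne.symm j.2), Matrix.zero_apply]

theorem det_one_sub_of_isNilpotent {n : Type*} [Fintype n] [DecidableEq n] [IsDomain R]
    (M : Matrix n n R) (hM : IsNilpotent M) : (1 - M).det = 1 := by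
  have h := (Matrix.isNilpotent_charpoly_sub_pow_of_isNilpotent hM).eq_zero
  have h2 := Matrix.eval_charpoly M 1
  rw [sub_eq_zero.mp h] at h2
  simpa using h2.symm

open Classical in
theorem det_one_sub_stepMatrix [IsDomain R] (r : V) (ν : {v : V // v ≠ r} → V) :
    (1 - stepMatrix R r ν).det =
      if ∀ i : {v : V // v ≠ r}, ∃ k : ℕ, (extendRoot r ν)^[k] i.1 = r then 1 else 0 := by
  split_ifs with h
  · exact det_one_sub_of_isNilpotent _ (isNilpotent_stepMatrix r ν h)
  · push Not at h
    obtain ⟨i₀, hi₀⟩ := h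
    -- The kernel vector is the indicator of the vertices that never reach the root; it is invariant
    -- under one step.
    refine Matrix.exists_mulVec_eq_zero_iff.mp
      ⟨fun i => if ∃ k : ℕ, (extendRoot r ν)^[k] i.1 = r then 0 else 1, ?_, ?_⟩
    · intro h0
      have := congrFun h0 i₀
      simp [hi₀] at this
    · ext i
      rw [Matrix.sub_mulVec, Matrix.one_mulVec, Pi.sub_apply, Pi.zero_apply, sub_eq_zero]
      have key : (∃ k : ℕ, (extendRoot r ν)^[k] i.1 = r) ↔
          ∃ k : ℕ, (extendRoot r ν)^[k] (ν i) = r := by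
        constructor
        · rintro ⟨k, hk⟩
          refine ⟨k, ?_⟩
          rw [← extendRoot_coe r ν, ← Function.iterate_succ_apply, Function.iterate_succ_apply', hk,
            extendRoot_root]
        · rintro ⟨k, hk⟩
          exact ⟨k + 1, by rwa [Function.iterate_succ_apply, extendRoot_coe]⟩
      by_cases hr : ν i = r
      · rw [if_pos (key.mpr ⟨0, hr⟩), Matrix.mulVec, dotProduct, Finset.sum_eq_zero]
        intro l _
        simp [stepMatrix, hr, Ne.symm l.2]
      · rw [Matrix.mulVec, dotProduct, Finset.sum_eq_single ⟨ν i, hr⟩]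
        · simp only [stepMatrix, Matrix.of_apply, if_true, one_mul]
          exact if_congr key rfl rfl
        · intro l _ hl
          have : ν i ≠ l.1 := fun h' => hl (Subtype.ext h'.symm)
          simp [stepMatrix, this]
        · simp

/-- The Laplacian of the arc weights `w`, with the row and the column of the root deleted. -/
def reducedLaplacian (r : V) (w : {v : V // v ≠ r} → V → R) :
    Matrix {v : V // v ≠ r} {v : V // v ≠ r} R :=
  Matrix.of fun i j => (if i = j then ∑ k, w i k else 0) - w i j.1

open Classical in
theorem det_reducedLaplacian [IsDomain R] (r : V) (w : {v : V // v ≠ r} → V → R) :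
    (reducedLaplacian r w).det =
      ∑ ν : {v : V // v ≠ r} → V with
        ∀ i : {v : V // v ≠ r}, ∃ k : ℕ, (extendRoot r ν)^[k] i.1 = r,
          ∏ i, w i (ν i) := by
  -- Row `i` is the combination of the vectors `e_i - e_k` with weights `w i k`, where `e_r` reads
  -- as zero. Multilinearity in the rows then turns the choice of one `k` per row into a map `ν`,
  -- and only tree maps have a nonzero determinant.
  have hrow : reducedLaplacian r w = fun i => ∑ k : V, w i k •
      (fun j : {v : V // v ≠ r} => ((if i = j then 1 else 0) - if k = j.1 then 1 else 0 : R)) := by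
    ext i j
    simp [reducedLaplacian, mul_sub, Finset.sum_sub_distrib]
  rw [hrow]
  change (Matrix.detRowAlternating (R := R)).toMultilinearMap _ = _
  rw [MultilinearMap.map_sum, Finset.sum_filter]
  refine Finset.sum_congr rfl fun ν _ => ?_
  rw [MultilinearMap.map_smul_univ]
  have h2 := det_one_sub_stepMatrix (R := R) r ν
  change Matrix.detRowAlternating _ = _ at h2
  have h3 : (fun i j : {v : V // v ≠ r} =>
      ((if i = j then 1 else 0) - if ν i = j.1 then 1 else 0 : R)) =
      (1 - stepMatrix R r ν : Matrix _ _ R) := by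
    ext i j
    simp [stepMatrix, Matrix.one_apply]
  rw [h3]
  change _ • Matrix.detRowAlternating _ = _
  rw [h2]
  simp

end MatrixTree

/-! ### Newton's identities for the characteristic polynomial -/

section Newton

open Polynomial

variable {n R : Type*} [Fintype n] [DecidableEq n] [CommRing R]

theorem Matrix.derivative_det_eq_sum_updateRow (M : Matrix n n R[X]) :
    derivative M.det = ∑ i, (M.updateRow i fun j => derivative (M i j)).det := by
  simp_rw [← Matrix.det_transpose (Matrix.updateRow _ _ _), ← Matrix.det_transpose M,
    Matrix.det_apply, derivative_sum]
  rw [Finset.sum_comm]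
  refine Finset.sum_congr rfl fun σ _ => ?_
  rw [← Finset.smul_sum, Units.smul_def, Units.smul_def, derivative_smul]
  congr 1
  simp only [Matrix.transpose_apply]
  rw [derivative_prod_finset]
  refine Finset.sum_congr rfl fun i _ => ?_
  rw [← Finset.mul_prod_erase _ _ (Finset.mem_univ i), mul_comm, Matrix.updateRow_self]
  congr 1
  refine Finset.prod_congr rfl fun j hj => ?_
  rw [Matrix.updateRow_ne (Finset.ne_of_mem_erase hj)]

theorem Matrix.derivative_charpoly_eq_trace_adjugate (A : Matrix n n R) :
    derivative A.charpoly = A.charmatrix.adjugate.trace := by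
  rw [Matrix.charpoly, Matrix.derivative_det_eq_sum_updateRow]
  refine Finset.sum_congr rfl fun i _ => ?_
  rw [Matrix.diag_apply, Matrix.adjugate_apply]
  congr 2
  ext j
  by_cases h : i = j
  · subst h; simp
  · simp [h, Ne.symm h]

/-- With `p` the characteristic polynomial, the right side is the quotient `(p(X) - p(A)) / (X - A)`
written with geometric sums. As `p(A) = 0` by Cayley–Hamilton, it satisfies the defining equation of
the adjugate, and the monic `p` can be cancelled. No roots are needed, so this works over any
commutative ring. -/
theorem Matrix.adjugate_charmatrix (A : Matrix n n R) :
    A.charmatrix.adjugate = ∑ i ∈ Finset.range (A.charpoly.natDegree + 1), ∑ j ∈ Finset.range i,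
      (C (A.charpoly.coeff i) * X ^ j) • (A ^ (i - 1 - j)).map C := by
  set B := ∑ i ∈ Finset.range (A.charpoly.natDegree + 1), ∑ j ∈ Finset.range i,
      (C (A.charpoly.coeff i) * X ^ j) • (A ^ (i - 1 - j)).map C with hB
  have hmap (k : ℕ) : (A ^ k).map C = ((C : R →+* R[X]).mapMatrix A) ^ k := by
    rw [← map_pow]; rfl
  have hcm : A.charmatrix = (X : R[X]) • (1 : Matrix n n R[X]) - (C : R →+* R[X]).mapMatrix A := by
    rw [Matrix.charmatrix, Matrix.scalar_apply, ← Matrix.smul_one_eq_diagonal]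
  have hcomm : Commute ((X : R[X]) • (1 : Matrix n n R[X])) ((C : R →+* R[X]).mapMatrix A) :=
    (Commute.one_left _).smul_left _
  have hmul : B * A.charmatrix = A.charpoly • 1 := by
    have hCH : ∑ i ∈ Finset.range (A.charpoly.natDegree + 1),
        C (A.charpoly.coeff i) • (C : R →+* R[X]).mapMatrix A ^ i = 0 := by
      have h := A.aeval_self_charpoly
      rw [aeval_eq_sum_range] at h
      have h2 := congrArg (C : R →+* R[X]).mapMatrix h
      rw [map_zero, map_sum] at h2
      rw [← h2]
      refine Finset.sum_congr rfl fun i _ => ?_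
      rw [← map_pow]
      ext a b
      simp
    have hX : A.charpoly • (1 : Matrix n n R[X]) = ∑ i ∈ Finset.range (A.charpoly.natDegree + 1),
        C (A.charpoly.coeff i) • ((X : R[X]) • (1 : Matrix n n R[X])) ^ i := by
      conv_lhs => rw [A.charpoly.as_sum_range_C_mul_X_pow, Finset.sum_smul]
      refine Finset.sum_congr rfl fun i _ => ?_
      rw [_root_.smul_pow, one_pow, smul_smul]
    rw [hX, ← sub_zero (∑ i ∈ _, _), ← hCH, ← Finset.sum_sub_distrib, hB, Finset.sum_mul]
    refine Finset.sum_congr rfl fun i _ => ?_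
    rw [← smul_sub, ← hcomm.geom_sum₂_mul, hcm, ← smul_mul_assoc]
    congr 1
    rw [Finset.smul_sum]
    refine Finset.sum_congr rfl fun j _ => ?_
    rw [_root_.smul_pow, one_pow, hmap, smul_mul_assoc, one_mul, smul_smul]
  have h : A.charpoly • A.charmatrix.adjugate = A.charpoly • B := by
    calc A.charpoly • A.charmatrix.adjugate = (B * A.charmatrix) * A.charmatrix.adjugate := by
          rw [hmul, smul_mul_assoc, one_mul]
      _ = A.charpoly • B := by
          rw [mul_assoc, Matrix.mul_adjugate, Matrix.mul_smul, mul_one, Matrix.charpoly]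
  ext1 a b
  have := congrFun (congrFun h a) b
  rw [Matrix.smul_apply, Matrix.smul_apply, smul_eq_mul, smul_eq_mul] at this
  exact A.charpoly_monic.isRegular.left this

theorem Matrix.charpoly_coeff_succ_mul (A : Matrix n n R) (k : ℕ) :
    A.charpoly.coeff (k + 1) * (k + 1) =
      ∑ i ∈ Finset.range (A.charpoly.natDegree + 1) with k < i,
        A.charpoly.coeff i * (A ^ (i - 1 - k)).trace := by
  have h := congrArg (fun p => p.coeff k) A.derivative_charpoly_eq_trace_adjugate
  simp only [coeff_derivative] at h
  rw [h, Matrix.adjugate_charmatrix, Matrix.trace_sum, finsetSum_coeff, Finset.sum_filter]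
  refine Finset.sum_congr rfl fun i _ => ?_
  rw [Matrix.trace_sum, finsetSum_coeff]
  have hj (j : ℕ) : (((C (A.charpoly.coeff i) * X ^ j) • (A ^ (i - 1 - j)).map C).trace).coeff k =
      if k = j then A.charpoly.coeff i * (A ^ (i - 1 - j)).trace else 0 := by
    have : ((A ^ (i - 1 - j)).map C).trace = C (A ^ (i - 1 - j)).trace := by
      simp [Matrix.trace, map_sum]
    rw [Matrix.trace_smul, this, smul_eq_mul, mul_right_comm, ← C_mul, coeff_C_mul_X_pow]
  simp_rw [hj]
  rw [Finset.sum_ite_eq]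
  simp

/-- Newton's identity between the coefficients of the characteristic polynomial and the traces
of the powers. -/
theorem Matrix.newton_charpoly [Nontrivial R] (A : Matrix n n R) (m k : ℕ)
    (hk : m + k = Fintype.card n) :
    (m : R) * A.charpoly.coeff k =
      -∑ i ∈ Finset.range m, (A ^ (i + 1)).trace * A.charpoly.coeff (k + 1 + i) := by
  rcases Nat.eq_zero_or_pos k with rfl | hk0
  -- The constant coefficient is invisible to the derivative; here the identity is the trace of
  -- Cayley–Hamilton.
  · have h := congrArg Matrix.trace A.aeval_self_charpoly
    rw [aeval_eq_sum_range, Matrix.charpoly_natDegree_eq_dim, Finset.sum_range_succ', ← hk,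
      Matrix.trace_add, Matrix.trace_sum] at h
    simp only [pow_zero, Matrix.trace_smul, Matrix.trace_one, Matrix.trace_zero, smul_eq_mul] at h
    rw [← hk, add_zero] at h
    rw [mul_comm, eq_neg_iff_add_eq_zero, ← h, add_comm]
    congr 1
    refine Finset.sum_congr rfl fun i _ => ?_
    rw [mul_comm]
    congr 2; omega
  · obtain ⟨k, rfl⟩ := Nat.exists_eq_succ_of_ne_zero hk0.ne'
    have h := A.charpoly_coeff_succ_mul k
    rw [Matrix.charpoly_natDegree_eq_dim, ← hk] at h
    have hsum : ∑ i ∈ Finset.range (m + k.succ + 1) with k < i,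
        A.charpoly.coeff i * (A ^ (i - 1 - k)).trace =
        ∑ i ∈ Finset.range (m + 1), A.charpoly.coeff (k + 1 + i) * (A ^ i).trace := by
      symm
      refine Finset.sum_bij (fun i _ => k + 1 + i) ?_ ?_ ?_ ?_
      · intro i hi
        simp only [Finset.mem_filter, Finset.mem_range] at hi ⊢
        omega
      · intro i _ j _ h
        omega
      · intro i hi
        simp only [Finset.mem_filter, Finset.mem_range] at hi
        exact ⟨i - (k + 1), by simp only [Finset.mem_range]; omega, by omega⟩
      · intro i _
        congr 3; omega
    rw [hsum, Finset.sum_range_succ'] at h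
    simp only [pow_zero, Matrix.trace_one, add_zero] at h
    rw [← hk] at h
    push_cast at h
    have h2 : ∑ i ∈ Finset.range m, A.charpoly.coeff (k + 1 + (i + 1)) * (A ^ (i + 1)).trace =
        ∑ i ∈ Finset.range m, (A ^ (i + 1)).trace * A.charpoly.coeff (k.succ + 1 + i) := by
      refine Finset.sum_congr rfl fun i _ => ?_
      rw [mul_comm]
      congr 2; simp only [Nat.succ_eq_add_one]; ring
    rw [h2] at h
    rw [Nat.succ_eq_add_one] at h ⊢
    linear_combination -h

end Newton

/-! ### Small circuits of fan-in two -/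

section StraightLine

variable {σ : Type}

/-- The polynomials `f 0, …, f (s - 1)` are computed one after the other by gates of fan-in two. -/
def StraightLine (s : ℕ) (f : ℕ → MvPolynomial σ ℝ) : Prop :=
  ∀ i < s, ∃ g : Gate σ i, g.fanin ≤ 2 ∧ g.eval (fun j => f j) = f i

/-- `a` is a variable, a constant or one of `f 0, …, f (s - 1)`. -/
def Available (s : ℕ) (f : ℕ → MvPolynomial σ ℝ) (a : MvPolynomial σ ℝ) : Prop :=
  ∃ o : Operand σ s, o.eval (fun j => f j) = a

/-- All polynomials in `B` are computed by one circuit of fan-in two with at most `s` gates. -/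
def ComputableWith (s : ℕ) (B : Set (MvPolynomial σ ℝ)) : Prop :=
  ∃ t ≤ s, ∃ f, StraightLine t f ∧ ∀ b ∈ B, Available t f b

theorem StraightLine.exists_circuit {s : ℕ} {f : ℕ → MvPolynomial σ ℝ} (h : StraightLine s f)
    {a : MvPolynomial σ ℝ} (ha : Available s f a) :
    ∃ C : Circuit σ, C.FaninTwo ∧ C.Computes a ∧ C.size = s := by
  choose g hg using h
  obtain ⟨o, rfl⟩ := ha
  let C : Circuit σ := ⟨s, fun i => g i i.2, o⟩
  have hv (i : ℕ) (hi : i < s) : C.value ⟨i, hi⟩ = f i := by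
    induction i using Nat.strong_induction_on with
    | _ i ih =>
      rw [Circuit.value, ← (hg i hi).2]
      congr 1
      funext j
      exact ih j j.2 _
  refine ⟨C, fun i => (hg i i.2).1, ?_, rfl⟩
  unfold Circuit.Computes
  congr 1
  funext j
  exact hv j j.2

theorem ComputableWith.exists_circuit {s : ℕ} {B : Set (MvPolynomial σ ℝ)}
    (h : ComputableWith s B) {a : MvPolynomial σ ℝ} (ha : a ∈ B) :
    ∃ C : Circuit σ, C.FaninTwo ∧ C.Computes a ∧ C.size ≤ s := by
  obtain ⟨t, hts, f, hf, hB⟩ := h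
  obtain ⟨C, h1, h2, rfl⟩ := hf.exists_circuit (hB a ha)
  exact ⟨C, h1, h2, hts⟩

theorem ComputableWith.mono {s t : ℕ} {B B' : Set (MvPolynomial σ ℝ)} (h : ComputableWith s B)
    (hst : s ≤ t) (hB : B' ⊆ B) : ComputableWith t B' := by
  obtain ⟨u, hu, f, hf, h⟩ := h
  exact ⟨u, hu.trans hst, f, hf, fun b hb => h b (hB hb)⟩

theorem computableWith_inputs :
    ComputableWith 0 (Set.range (MvPolynomial.X (R := ℝ) (σ := σ)) ∪ Set.range MvPolynomial.C) := by
  refine ⟨0, le_rfl, fun _ => 0, fun i hi => absurd hi (Nat.not_lt_zero i), ?_⟩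
  rintro _ (⟨x, rfl⟩ | ⟨c, rfl⟩)
  · exact ⟨.var x, rfl⟩
  · exact ⟨.const c, rfl⟩

/-- Indexing the computed polynomials by all of `ℕ` lets a new gate be appended by updating the
sequence at position `t`, without changing earlier values. -/
theorem ComputableWith.gate {s : ℕ} {B : Set (MvPolynomial σ ℝ)} (h : ComputableWith s B)
    (a : Fin 2 → MvPolynomial σ ℝ) (ha : ∀ i, a i ∈ B) :
    ComputableWith (s + 1) (insert (∑ i, a i) B) ∧
      ComputableWith (s + 1) (insert (∏ i, a i) B) := by
  obtain ⟨t, ht, f, hf, h⟩ := h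
  choose o ho using fun i => h _ (ha i)
  have key (g : Gate σ t) (hg : g.fanin ≤ 2) :
      ComputableWith (s + 1) (insert (g.eval fun j => f j) B) := by
    have hlt {u : ℕ} (hu : u ≤ t) : (fun j : Fin u => Function.update f t
        (g.eval fun j => f j) j) = fun j : Fin u => f j := by
      funext j
      exact Function.update_of_ne (by omega) _ _
    refine ⟨t + 1, by omega, Function.update f t (g.eval fun j => f j), ?_, ?_⟩
    · intro i hi
      rcases Nat.lt_succ_iff_lt_or_eq.mp hi with hi | rfl
      · obtain ⟨g', hg', he⟩ := hf i hi
        refine ⟨g', hg', ?_⟩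
        rw [hlt hi.le, he, Function.update_of_ne hi.ne]
      · refine ⟨g, hg, ?_⟩
        rw [hlt le_rfl, Function.update_self]
    · rintro b (rfl | hb)
      · refine ⟨.gate (Fin.last t), ?_⟩
        simp [Operand.eval]
      · obtain ⟨o', rfl⟩ := h b hb
        cases o' with
        | var x => exact ⟨.var x, rfl⟩
        | const c => exact ⟨.const c, rfl⟩
        | gate j => exact ⟨.gate j.castSucc, congrFun (hlt le_rfl) j⟩
  constructor
  · have := key (.add 2 o) le_rfl
    simpa only [Gate.eval, ho] using this
  · have := key (.mul 2 o) le_rfl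
    simpa only [Gate.eval, ho] using this

/-- The polynomial `a` can be added with `t` more gates to every circuit that computes all
polynomials in `B`. -/
def Derivable (B : Set (MvPolynomial σ ℝ)) (t : ℕ) (a : MvPolynomial σ ℝ) : Prop :=
  -- Quantifying over all larger sets lets derivations be chained while keeping everything computed
  -- so far.
  ∀ s B', B ⊆ B' → ComputableWith s B' → ComputableWith (s + t) (insert a B')

theorem Derivable.of_mem {B : Set (MvPolynomial σ ℝ)} {a : MvPolynomial σ ℝ} (ha : a ∈ B) :
    Derivable B 0 a := by
  intro s B' hB h
  rwa [Set.insert_eq_of_mem (hB ha)]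

theorem Derivable.mono {B : Set (MvPolynomial σ ℝ)} {t u : ℕ} {a : MvPolynomial σ ℝ}
    (h : Derivable B t a) (htu : t ≤ u) : Derivable B u a :=
  fun s B' hB hs => (h s B' hB hs).mono (by omega) subset_rfl

theorem Derivable.add {B : Set (MvPolynomial σ ℝ)} {t u : ℕ} {a b : MvPolynomial σ ℝ}
    (ha : Derivable B t a) (hb : Derivable B u b) : Derivable B (t + u + 1) (a + b) := by
  intro s B' hB h
  have h1 := hb _ _ (hB.trans (Set.subset_insert _ _)) (ha s B' hB h)
  have h2 := (h1.gate ![a, b] (by intro i; fin_cases i <;> simp)).1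
  refine h2.mono (by omega) ?_
  rw [Fin.sum_univ_two]
  refine Set.insert_subset_insert ?_
  exact (Set.subset_insert _ _).trans (Set.subset_insert _ _)

theorem Derivable.mul {B : Set (MvPolynomial σ ℝ)} {t u : ℕ} {a b : MvPolynomial σ ℝ}
    (ha : Derivable B t a) (hb : Derivable B u b) : Derivable B (t + u + 1) (a * b) := by
  intro s B' hB h
  have h1 := hb _ _ (hB.trans (Set.subset_insert _ _)) (ha s B' hB h)
  have h2 := (h1.gate ![a, b] (by intro i; fin_cases i <;> simp)).2
  refine h2.mono (by omega) ?_
  rw [Fin.prod_univ_two]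
  refine Set.insert_subset_insert ?_
  exact (Set.subset_insert _ _).trans (Set.subset_insert _ _)

theorem Derivable.sum {ι : Type*} {B : Set (MvPolynomial σ ℝ)} {t : ℕ} (S : Finset ι)
    (f : ι → MvPolynomial σ ℝ) (h0 : (0 : MvPolynomial σ ℝ) ∈ B)
    (h : ∀ i ∈ S, Derivable B t (f i)) : Derivable B (S.card * (t + 1)) (∑ i ∈ S, f i) := by
  classical
  induction S using Finset.induction_on with
  | empty => simpa using Derivable.of_mem h0
  | insert i S hi ih =>
    rw [Finset.sum_insert hi, Finset.card_insert_of_notMem hi]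
    refine ((h i (Finset.mem_insert_self _ _)).add
      (ih fun j hj => h j (Finset.mem_insert_of_mem hj))).mono ?_
    exact (by ring_nf; exact le_rfl)

theorem ComputableWith.family {ι : Type*} {B : Set (MvPolynomial σ ℝ)} {s t : ℕ} (S : Finset ι)
    (f : ι → MvPolynomial σ ℝ) (h : ComputableWith s B) (hf : ∀ i ∈ S, Derivable B t (f i)) :
    ComputableWith (s + S.card * t) (B ∪ f '' S) := by
  classical
  induction S using Finset.induction_on with
  | empty => simpa using h
  | insert i S hi ih =>
    have h1 := hf i (Finset.mem_insert_self _ _) _ _ Set.subset_union_left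
      (ih fun j hj => hf j (Finset.mem_insert_of_mem hj))
    refine h1.mono ?_ ?_
    · rw [Finset.card_insert_of_notMem hi]
      exact (by ring_nf; exact le_rfl)
    · rw [Finset.coe_insert, Set.image_insert_eq, Set.union_insert]

end StraightLine

/-! ### A polynomial size circuit for the determinant -/

section DetCircuit

open MvPolynomial

variable {σ : Type} {m : Type*} [Fintype m] [DecidableEq m]

theorem ComputableWith.matrix_pow {s : ℕ} {B : Set (MvPolynomial σ ℝ)} (hs : ComputableWith s B)
    (h0 : (0 : MvPolynomial σ ℝ) ∈ B) (A : Matrix m m (MvPolynomial σ ℝ))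
    (hA : ∀ i j, A i j ∈ B) (k : ℕ) :
    ∃ B', B ⊆ B' ∧ (∀ l ≤ k, ∀ i j, (A ^ (l + 1)) i j ∈ B') ∧
      ComputableWith (s + k * (2 * Fintype.card m ^ 3)) B' := by
  induction k with
  | zero =>
    refine ⟨B, subset_rfl, fun l hl i j => ?_, by simpa using hs⟩
    rw [Nat.le_zero.mp hl, zero_add, pow_one]
    exact hA i j
  | succ k ih =>
    obtain ⟨B', hB, hp, hc⟩ := ih
    have hd (ij : m × m) : Derivable B' (Fintype.card m * (1 + 1)) ((A ^ (k + 2)) ij.1 ij.2) := by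
      rw [pow_succ, Matrix.mul_apply]
      refine Derivable.sum Finset.univ _ (hB h0) fun l _ => ?_
      exact (Derivable.of_mem (hp k le_rfl _ _)).mul (Derivable.of_mem (hB (hA _ _)))
    refine ⟨_, ?_, ?_, (hc.family Finset.univ _ fun ij _ => hd ij).mono ?_ subset_rfl⟩
    · exact hB.trans Set.subset_union_left
    · intro l hl i j
      rcases Nat.le_succ_iff.mp hl with hl | rfl
      · exact Or.inl (hp l hl i j)
      · exact Or.inr ⟨(i, j), Finset.mem_coe.mpr (Finset.mem_univ _), rfl⟩
    · rw [Finset.card_univ, Fintype.card_prod]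
      exact le_of_eq (by ring)

theorem ComputableWith.charpoly_coeff {s : ℕ} {B : Set (MvPolynomial σ ℝ)}
    (hs : ComputableWith s B) (hC : Set.range (C : ℝ →+* MvPolynomial σ ℝ) ⊆ B)
    (A : Matrix m m (MvPolynomial σ ℝ))
    (ht : ∀ l < Fintype.card m, (A ^ (l + 1)).trace ∈ B) (k : ℕ) (hk : k ≤ Fintype.card m) :
    ∃ B', B ⊆ B' ∧ (∀ l, Fintype.card m ≤ l + k → l ≤ Fintype.card m →
      A.charpoly.coeff l ∈ B') ∧
      ComputableWith (s + k * (2 * Fintype.card m + 1)) B' := by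
  induction k with
  | zero =>
    refine ⟨B, subset_rfl, fun l hl hl' => ?_, by simpa using hs⟩
    obtain rfl : l = Fintype.card m := by omega
    have h := A.charpoly_monic.coeff_natDegree
    rw [A.charpoly_natDegree_eq_dim] at h
    rw [h]
    exact hC ⟨1, map_one _⟩
  | succ k ih =>
    obtain ⟨B', hB, hp, hc⟩ := ih (by omega)
    obtain ⟨l, hl⟩ := Nat.exists_eq_add_of_le hk
    have hd : Derivable B' (2 * Fintype.card m + 1) (A.charpoly.coeff l) := by
      have hN := A.newton_charpoly (k + 1) l hl.symm
      have hk0 : ((k + 1 : ℕ) : ℝ) ≠ 0 := by positivity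
      -- Newton's identity is solved for the next lower coefficient; the division by `k + 1` becomes
      -- a negative real constant.
      have hcoeff : A.charpoly.coeff l = C (-((k + 1 : ℕ) : ℝ)⁻¹) *
          ∑ i ∈ Finset.range (k + 1), (A ^ (i + 1)).trace * A.charpoly.coeff (l + 1 + i) := by
        rw [map_neg, neg_mul, ← mul_neg, ← hN, ← mul_assoc, ← map_natCast C, ← C_mul,
          inv_mul_cancel₀ hk0, C_1, one_mul]
      rw [hcoeff]
      refine (Derivable.mul (Derivable.of_mem (hB (hC ⟨_, rfl⟩)))
        (Derivable.sum (t := 1) (Finset.range (k + 1)) _ (hB (hC ⟨0, map_zero _⟩))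
          fun i hi => ?_)).mono ?_
      · rw [Finset.mem_range] at hi
        exact (Derivable.of_mem (hB (ht i (by omega)))).mul
          (Derivable.of_mem (hp _ (by omega) (by omega)))
      · rw [Finset.card_range]
        omega
    refine ⟨_, hB.trans (Set.subset_insert _ _), fun l' h1 h2 => ?_,
      (hd _ _ subset_rfl hc).mono (by rw [add_mul, one_mul]; omega) subset_rfl⟩
    rcases Nat.lt_or_ge (l' + k) (Fintype.card m) with h | h
    · obtain rfl : l' = l := by omega
      exact Set.mem_insert _ _
    · exact Set.mem_insert_of_mem _ (hp l' h h2)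

/-- The Faddeev–LeVerrier circuit for the determinant. -/
theorem ComputableWith.det {s : ℕ} {B : Set (MvPolynomial σ ℝ)}
    (hs : ComputableWith s B) (hC : Set.range (C : ℝ →+* MvPolynomial σ ℝ) ⊆ B)
    (A : Matrix m m (MvPolynomial σ ℝ)) (hA : ∀ i j, A i j ∈ B) :
    ∃ K : Circuit σ, K.FaninTwo ∧ K.Computes A.det ∧
      K.size ≤ s + (2 * Fintype.card m ^ 4 + 3 * Fintype.card m ^ 2 + Fintype.card m + 1) := by
  have h0 : (0 : MvPolynomial σ ℝ) ∈ B := hC ⟨0, map_zero _⟩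
  obtain ⟨B₁, hB₁, hp, hc₁⟩ := hs.matrix_pow h0 A hA (Fintype.card m)
  have htr (l : ℕ) (hl : l ∈ Finset.range (Fintype.card m)) :
      Derivable B₁ (Fintype.card m * (0 + 1)) (A ^ (l + 1)).trace := by
    rw [Finset.mem_range] at hl
    exact Derivable.sum Finset.univ _ (hB₁ h0) fun i _ => Derivable.of_mem (hp l hl.le _ _)
  obtain ⟨B₂, hB₂, hch, hc₂⟩ := (hc₁.family _ _ htr).charpoly_coeff
    ((hC.trans hB₁).trans Set.subset_union_left) A
    (fun l hl => Or.inr ⟨l, Finset.mem_coe.mpr (Finset.mem_range.mpr hl), rfl⟩) _ le_rfl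
  have hd : Derivable B₂ 1 A.det := by
    rw [Matrix.det_eq_sign_charpoly_coeff]
    refine Derivable.mul (t := 0) (u := 0) (Derivable.of_mem ?_)
      (Derivable.of_mem (hch 0 (by omega) (by omega)))
    refine hB₂ (Or.inl (hB₁ (hC ⟨(-1) ^ Fintype.card m, ?_⟩)))
    simp
  obtain ⟨K, h1, h2, h3⟩ := (hd _ _ subset_rfl hc₂).exists_circuit (Set.mem_insert _ _)
  refine ⟨K, h1, h2, h3.trans (le_of_eq ?_)⟩
  rw [Finset.card_range]
  ring

end DetCircuit

/-! ### The spanning tree polynomials are in VP -/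

section SpanningTreePoly

open MvPolynomial

variable {V : Type} [Fintype V] [DecidableEq V]

open Classical in
theorem spanningTreePoly_eq_sum (G : SimpleGraph V) (r : V) :
    spanningTreePoly G r = ∑ ν : {v : V // v ≠ r} → V with
        ∀ i : {v : V // v ≠ r}, ∃ k : ℕ, (extendRoot r ν)^[k] i.1 = r,
          ∏ i, if G.Adj i.1 (ν i) then (X (i.1, ν i) : MvPolynomial (V × V) ℝ) else 0 := by
  rw [spanningTreePoly, Finset.sum_filter, Finset.sum_filter]
  refine Finset.sum_congr rfl fun ν _ => ?_
  unfold IsDirectedSpanningTree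
  by_cases h1 : ∀ i : {v : V // v ≠ r}, ∃ k : ℕ, (extendRoot r ν)^[k] i.1 = r
  · by_cases h2 : ∀ i : {v : V // v ≠ r}, G.Adj i.1 (ν i)
    · rw [if_pos ⟨h1, h2⟩, if_pos h1]
      exact Finset.prod_congr rfl fun i _ => (if_pos (h2 i)).symm
    · rw [if_neg fun h => h2 h.2, if_pos h1]
      push Not at h2
      obtain ⟨i, hi⟩ := h2
      exact (Finset.prod_eq_zero (Finset.mem_univ i) (if_neg hi)).symm
  · rw [if_neg fun h => h1 h.1, if_neg h1]

open Classical in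
theorem spanningTreePoly_eq_det (G : SimpleGraph V) (r : V) :
    spanningTreePoly G r = (reducedLaplacian r fun i j =>
      if G.Adj i.1 j then (X (i.1, j) : MvPolynomial (V × V) ℝ) else 0).det := by
  rw [det_reducedLaplacian, spanningTreePoly_eq_sum]

theorem exists_circuit_spanningTreePoly (G : SimpleGraph V) (r : V) :
    ∃ K : Circuit (V × V), K.FaninTwo ∧ K.Computes (spanningTreePoly G r) ∧
      K.size ≤ 10 * (Fintype.card V + 1) ^ 4 := by
  classical
  set w : {v : V // v ≠ r} → V → MvPolynomial (V × V) ℝ := fun i j =>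
      if G.Adj i.1 j then X (i.1, j) else 0 with hw
  set B : Set (MvPolynomial (V × V) ℝ) := Set.range X ∪ Set.range C
  have hwB (i j) : w i j ∈ B := by
    rw [hw]
    dsimp only
    split_ifs
    · exact Or.inl ⟨_, rfl⟩
    · exact Or.inr ⟨0, map_zero _⟩
  have hd (ij : {v : V // v ≠ r} × {v : V // v ≠ r}) :
      Derivable B (Fintype.card V + 2) (reducedLaplacian r w ij.1 ij.2) := by
    have hentry : reducedLaplacian r w ij.1 ij.2 =
        (if ij.1 = ij.2 then ∑ k, w ij.1 k else 0) + C (-1) * w ij.1 ij.2.1 := by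
      rw [reducedLaplacian, Matrix.of_apply, map_neg, C_1, sub_eq_add_neg, neg_one_mul]
    rw [hentry]
    have h1 : Derivable B (Fintype.card V) (if ij.1 = ij.2 then ∑ k, w ij.1 k else 0) := by
      split_ifs
      · simpa using Derivable.sum (t := 0) Finset.univ (w ij.1) (Or.inr ⟨0, map_zero _⟩)
          fun k _ => Derivable.of_mem (hwB _ _)
      · exact (Derivable.of_mem (Or.inr ⟨0, map_zero _⟩)).mono (Nat.zero_le _)
    exact (h1.add ((Derivable.of_mem (Or.inr ⟨-1, rfl⟩)).mul
      (Derivable.of_mem (hwB _ _)))).mono (by omega)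
  obtain ⟨K, h1, h2, h3⟩ := (computableWith_inputs.family Finset.univ _ fun ij _ => hd ij).det
    (Set.subset_union_right.trans Set.subset_union_left) (reducedLaplacian r w)
    (fun i j => Or.inr ⟨(i, j), Finset.mem_coe.mpr (Finset.mem_univ _), rfl⟩)
  refine ⟨K, h1, ?_, h3.trans ?_⟩
  · rw [spanningTreePoly_eq_det]
    exact h2
  · have hN : Fintype.card {v : V // v ≠ r} ≤ Fintype.card V := Fintype.card_subtype_le _
    rw [Finset.card_univ, Fintype.card_prod]
    generalize Fintype.card {v : V // v ≠ r} = N at hN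
    generalize Fintype.card V = M at hN
    calc _ ≤ 0 + M * M * (M + 2) + (2 * M ^ 4 + 3 * M ^ 2 + M + 1) := by gcongr
      _ ≤ 10 * (M + 1) ^ 4 := by
        ring_nf
        nlinarith [Nat.zero_le (M ^ 4), Nat.zero_le (M ^ 3), Nat.zero_le (M ^ 2)]

theorem totalDegree_spanningTreePoly_le (G : SimpleGraph V) (r : V) :
    (spanningTreePoly G r).totalDegree ≤ Fintype.card V := by
  refine totalDegree_finsetSum_le fun ν _ => ?_
  refine (totalDegree_finsetProd _ _).trans ?_
  simp only [totalDegree_X]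
  simp

theorem inVP_spanningTreePoly (G : ∀ n : ℕ, SimpleGraph (Fin (n + 1)))
    (r : ∀ n : ℕ, Fin (n + 1)) : InVP fun n => spanningTreePoly (G n) (r n) := by
  refine ⟨10 * (Polynomial.X + 2) ^ 4, fun n => ?_⟩
  have hp : Polynomial.eval n (10 * (Polynomial.X + 2) ^ 4 : Polynomial ℕ) = 10 * (n + 2) ^ 4 := by
    simp
  have h1 : n + 2 ≤ (n + 2) ^ 4 := Nat.le_self_pow (by norm_num) _
  have h2 : (n + 2) ^ 2 ≤ (n + 2) ^ 4 := Nat.pow_le_pow_right (by omega) (by norm_num)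
  have hcard : Fintype.card (Fin (n + 1)) = n + 1 := Fintype.card_fin _
  rw [hp]
  refine ⟨?_, ?_, ?_⟩
  · refine (Finset.card_le_univ _).trans ?_
    rw [Fintype.card_prod, hcard]
    nlinarith
  · refine (totalDegree_spanningTreePoly_le _ _).trans ?_
    omega
  · obtain ⟨K, hK1, hK2, hK3⟩ := exists_circuit_spanningTreePoly (G n) (r n)
    exact ⟨K, hK1, hK2, by rwa [hcard] at hK3⟩

end SpanningTreePoly

/-! ### Monotone circuits -/

section Nonneg

open MvPolynomial

variable {σ : Type}

/-- All coefficients of `p` are nonnegative. -/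
def NonnegCoeffs (p : MvPolynomial σ ℝ) : Prop :=
  ∀ m, 0 ≤ p.coeff m

theorem NonnegCoeffs.sum {ι : Type*} {S : Finset ι} {f : ι → MvPolynomial σ ℝ}
    (h : ∀ i ∈ S, NonnegCoeffs (f i)) : NonnegCoeffs (∑ i ∈ S, f i) := by
  intro m
  rw [coeff_sum]
  exact Finset.sum_nonneg fun i hi => h i hi m

theorem NonnegCoeffs.mul {p q : MvPolynomial σ ℝ} (hp : NonnegCoeffs p) (hq : NonnegCoeffs q) :
    NonnegCoeffs (p * q) := by
  classical
  intro m
  rw [coeff_mul]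
  exact Finset.sum_nonneg fun x _ => mul_nonneg (hp _) (hq _)

theorem nonnegCoeffs_monomial (m : σ →₀ ℕ) {c : ℝ} (hc : 0 ≤ c) :
    NonnegCoeffs (monomial m c) := by
  classical
  intro m'
  rw [coeff_monomial]
  split_ifs
  exacts [hc, le_rfl]

theorem NonnegCoeffs.prod {ι : Type*} {S : Finset ι} {f : ι → MvPolynomial σ ℝ}
    (h : ∀ i ∈ S, NonnegCoeffs (f i)) : NonnegCoeffs (∏ i ∈ S, f i) := by
  classical
  induction S using Finset.induction_on with
  | empty => exact nonnegCoeffs_monomial 0 zero_le_one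
  | insert i S hi ih =>
    rw [Finset.prod_insert hi]
    exact (h i (Finset.mem_insert_self _ _)).mul
      (ih fun j hj => h j (Finset.mem_insert_of_mem hj))

theorem NonnegCoeffs.mem_support_sum {ι : Type*} {S : Finset ι} {f : ι → MvPolynomial σ ℝ}
    (h : ∀ i ∈ S, NonnegCoeffs (f i)) {m : σ →₀ ℕ} :
    m ∈ (∑ i ∈ S, f i).support ↔ ∃ i ∈ S, m ∈ (f i).support := by
  rw [mem_support_iff, coeff_sum, Ne, Finset.sum_eq_zero_iff_of_nonneg fun i hi => h i hi m]
  push Not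
  simp only [mem_support_iff]

/-- Nonnegativity excludes cancellation: one positive term in the convolution keeps the whole
coefficient positive. -/
theorem NonnegCoeffs.add_mem_support_mul {p q : MvPolynomial σ ℝ} (hp : NonnegCoeffs p)
    (hq : NonnegCoeffs q) {a b : σ →₀ ℕ} (ha : a ∈ p.support) (hb : b ∈ q.support) :
    a + b ∈ (p * q).support := by
  classical
  rw [mem_support_iff] at ha hb ⊢
  rw [coeff_mul]
  have hpos : 0 < p.coeff a * q.coeff b :=
    mul_pos (lt_of_le_of_ne (hp a) ha.symm) (lt_of_le_of_ne (hq b) hb.symm)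
  exact (hpos.trans_le (Finset.single_le_sum (f := fun x : (σ →₀ ℕ) × (σ →₀ ℕ) =>
    p.coeff x.1 * q.coeff x.2) (fun x _ => mul_nonneg (hp _) (hq _))
    (Finset.HasAntidiagonal.mem_antidiagonal.mpr (rfl : (a, b).1 + (a, b).2 = a + b)))).ne'

theorem exists_add_of_mem_support_mul {p q : MvPolynomial σ ℝ} {m : σ →₀ ℕ}
    (hm : m ∈ (p * q).support) : ∃ a ∈ p.support, ∃ b ∈ q.support, a + b = m := by
  classical
  exact Finset.mem_add.mp (support_mul p q hm)

theorem NonnegCoeffs.sum_mem_support_prod {ι : Type*} {S : Finset ι}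
    {f : ι → MvPolynomial σ ℝ} (h : ∀ i ∈ S, NonnegCoeffs (f i)) {a : ι → σ →₀ ℕ}
    (ha : ∀ i ∈ S, a i ∈ (f i).support) : ∑ i ∈ S, a i ∈ (∏ i ∈ S, f i).support := by
  classical
  induction S using Finset.induction_on with
  | empty => simp
  | insert i S hi ih =>
    rw [Finset.prod_insert hi, Finset.sum_insert hi]
    exact (h i (Finset.mem_insert_self _ _)).add_mem_support_mul
      (NonnegCoeffs.prod fun j hj => h j (Finset.mem_insert_of_mem hj))
      (ha i (Finset.mem_insert_self _ _))
      (ih (fun j hj => h j (Finset.mem_insert_of_mem hj))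
        fun j hj => ha j (Finset.mem_insert_of_mem hj))

theorem exists_sum_of_mem_support_prod {ι : Type*} {S : Finset ι}
    {f : ι → MvPolynomial σ ℝ} {m : σ →₀ ℕ} (hm : m ∈ (∏ i ∈ S, f i).support) :
    ∃ a : ι → σ →₀ ℕ, (∀ i ∈ S, a i ∈ (f i).support) ∧ ∑ i ∈ S, a i = m := by
  classical
  induction S using Finset.induction_on generalizing m with
  | empty =>
    rw [Finset.prod_empty, support_one, Finset.mem_singleton] at hm
    exact ⟨0, by simp, by simp [hm]⟩
  | insert i S hi ih =>
    rw [Finset.prod_insert hi] at hm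
    obtain ⟨a, ha, b, hb, rfl⟩ := exists_add_of_mem_support_mul hm
    obtain ⟨c, hc, rfl⟩ := ih hb
    have hne : ∀ j ∈ S, Function.update c i a j = c j := fun j hj =>
      Function.update_of_ne (ne_of_mem_of_not_mem hj hi) _ _
    refine ⟨Function.update c i a, ?_, ?_⟩
    · intro j hj
      rcases Finset.mem_insert.mp hj with rfl | hj
      · rwa [Function.update_self]
      · rw [hne j hj]
        exact hc j hj
    · rw [Finset.sum_insert hi, Function.update_self, Finset.sum_congr rfl hne]

theorem Operand.IsMonotone.nonnegCoeffs {k : ℕ} {v : Fin k → MvPolynomial σ ℝ}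
    (hv : ∀ j, NonnegCoeffs (v j)) {o : Operand σ k} (ho : o.IsMonotone) :
    NonnegCoeffs (o.eval v) := by
  cases o with
  | var x => exact nonnegCoeffs_monomial _ zero_le_one
  | const c => exact nonnegCoeffs_monomial 0 ho
  | gate j => exact hv j

theorem Circuit.IsMonotone.nonnegCoeffs_value {C : Circuit σ} (hC : C.IsMonotone) (i : ℕ)
    (hi : i < C.size) : NonnegCoeffs (C.value ⟨i, hi⟩) := by
  induction i using Nat.strong_induction_on with
  | _ i ih =>
    have hg := hC.1 ⟨i, hi⟩
    rw [Circuit.value]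
    cases h : C.gate ⟨i, hi⟩ with
    | add k a =>
      rw [h] at hg
      exact NonnegCoeffs.sum fun j _ => (hg j).nonnegCoeffs fun l => ih l l.2 _
    | mul k a =>
      rw [h] at hg
      exact NonnegCoeffs.prod fun j _ => (hg j).nonnegCoeffs fun l => ih l l.2 _

/-- Adding weights below `D` one at a time cannot jump over the interval from `D` to `2 * D`. -/
theorem Finset.exists_subset_sum_lt_two_mul {ι : Type*} (S : Finset ι) (f : ι → ℕ) {D : ℕ}
    (hD : 0 < D) (hf : ∀ i ∈ S, f i < D) (hS : D ≤ ∑ i ∈ S, f i) :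
    ∃ J ⊆ S, D ≤ ∑ i ∈ J, f i ∧ ∑ i ∈ J, f i < 2 * D := by
  classical
  induction S using Finset.induction_on with
  | empty => exact ⟨∅, subset_rfl, hS, by rw [Finset.sum_empty]; omega⟩
  | insert i S hi ih =>
    by_cases h : D ≤ ∑ i ∈ S, f i
    · obtain ⟨J, hJ, h1⟩ := ih (fun j hj => hf j (Finset.mem_insert_of_mem hj)) h
      exact ⟨J, hJ.trans (Finset.subset_insert _ _), h1⟩
    · refine ⟨_, subset_rfl, hS, ?_⟩
      have := hf i (Finset.mem_insert_self _ _)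
      rw [Finset.sum_insert hi]
      omega

/-- The set `Q` of monomials of degree between `D` and `2 * D` splits off every monomial of `p`,
and the complementary factor may be combined with all of `Q`. -/
def IsBalancedFactor (D : ℕ) (p : MvPolynomial σ ℝ) (Q : Set (σ →₀ ℕ)) : Prop :=
  (∀ a ∈ Q, D ≤ a.degree ∧ a.degree < 2 * D) ∧
    ∀ m ∈ p.support, ∃ a ∈ Q, ∃ b, b + a = m ∧ ∀ a' ∈ Q, b + a' ∈ p.support

/-- Following a parse tree of a monomial leads to a gate with a balanced factor. -/
theorem Circuit.IsMonotone.exists_balancedFactor {C : Circuit σ} (hC : C.IsMonotone)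
    {U : Set (σ →₀ ℕ)} {N D : ℕ} (hU : ∀ m ∈ U, m.degree = N) (hD : 2 ≤ D)
    (i : ℕ) (hi : i < C.size) (a c : σ →₀ ℕ) (ha : a ∈ (C.value ⟨i, hi⟩).support)
    (hc : ∀ a' ∈ (C.value ⟨i, hi⟩).support, c + a' ∈ U) (hDa : D ≤ a.degree) :
    ∃ u a' c', c' + a' = c + a ∧ a' ∈ (C.value u).support ∧
      (∀ b ∈ (C.value u).support, c' + b ∈ U) ∧ ∃ Q, IsBalancedFactor D (C.value u) Q := by
  induction i using Nat.strong_induction_on generalizing a c with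
  | _ i ih =>
    have hg := hC.1 ⟨i, hi⟩
    have hval : C.value ⟨i, hi⟩ = (C.gate ⟨i, hi⟩).eval
      (fun j : Fin i => C.value ⟨j, j.2.trans hi⟩) := by rw [Circuit.value]
    set v : Fin i → MvPolynomial σ ℝ := fun j => C.value ⟨j, j.2.trans hi⟩ with hv
    have hnn (j : Fin i) : NonnegCoeffs (v j) := hC.nonnegCoeffs_value _ _
    -- Variables and constants have degree at most 1, so `2 ≤ D` forces the descent to continue at a
    -- gate.
    have hop (o : Operand σ i) (b : σ →₀ ℕ) (hb : b ∈ (o.eval v).support)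
        (hDb : D ≤ b.degree) : ∃ j : Fin i, o = .gate j := by
      cases o with
      | var x =>
        rw [Operand.eval, support_X, Finset.mem_singleton] at hb
        rw [hb, Finsupp.degree_single] at hDb
        omega
      | const t =>
        have := support_monomial_subset hb
        rw [Finset.mem_singleton] at this
        rw [this, map_zero] at hDb
        omega
      | gate j => exact ⟨j, rfl⟩
    cases h : C.gate ⟨i, hi⟩ with
    | add k o =>
      rw [h] at hg hval
      have hnn' : ∀ j ∈ Finset.univ, NonnegCoeffs ((o j).eval v) :=
        fun j _ => (hg j).nonnegCoeffs hnn
      rw [hval] at ha hc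
      obtain ⟨j, -, hj⟩ := (NonnegCoeffs.mem_support_sum hnn').mp ha
      obtain ⟨l, hl⟩ := hop (o j) a hj hDa
      have hlv : (o j).eval v = C.value ⟨l, l.2.trans hi⟩ := by rw [hl]; rfl
      refine ih l l.2 _ a c (hlv ▸ hj) (fun a' ha' => hc a' ?_) hDa
      exact (NonnegCoeffs.mem_support_sum hnn').mpr ⟨j, Finset.mem_univ _, hlv ▸ ha'⟩
    | mul k o =>
      rw [h] at hg hval
      have hnn' (j) : NonnegCoeffs ((o j).eval v) := (hg j).nonnegCoeffs hnn
      change _ = ∏ j, (o j).eval v at hval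
      have ha₀ := ha
      have hc₀ := hc
      rw [hval] at ha hc
      obtain ⟨b, hb, rfl⟩ := exists_sum_of_mem_support_prod ha
      by_cases hbig : ∃ j, D ≤ (b j).degree
      · obtain ⟨j, hj⟩ := hbig
        obtain ⟨l, hl⟩ := hop (o j) (b j) (hb j (Finset.mem_univ _)) hj
        have hlv : (o j).eval v = C.value ⟨l, l.2.trans hi⟩ := by rw [hl]; rfl
        -- The other factors' monomials move into the context `c`.
        have := ih l l.2 (l.2.trans hi) (b j) (c + ∑ x ∈ Finset.univ.erase j, b x)
          (hlv ▸ hb j (Finset.mem_univ _)) (fun a' ha' => ?_) hj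
        · rwa [add_assoc, Finset.sum_erase_add _ _ (Finset.mem_univ j)] at this
        · rw [add_assoc]
          refine hc _ ?_
          rw [← Finset.prod_erase_mul _ _ (Finset.mem_univ j)]
          exact (NonnegCoeffs.prod fun x _ => hnn' x).add_mem_support_mul (hnn' j)
            (NonnegCoeffs.sum_mem_support_prod (fun x _ => hnn' x) fun x _ =>
              hb x (Finset.mem_univ _)) (hlv ▸ ha')
      -- All factors are now small although their product is large: the descent stops, and a
      -- subproduct over `J` is balanced.
      · push Not at hbig
        rw [map_sum] at hDa
        obtain ⟨J, -, hJ1, hJ2⟩ := Finset.exists_subset_sum_lt_two_mul Finset.univ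
          (fun j => (b j).degree) (by omega) (fun j _ => hbig j) hDa
        refine ⟨⟨i, hi⟩, _, c, rfl, ha₀, hc₀, (∏ j ∈ J, (o j).eval v).support, ?_, ?_⟩
        · intro a' ha'
          -- Completing to monomials in `U`, which all have degree `N`, shows that all monomials of
          -- the subproduct have equal degree.
          have hsplit (x : σ →₀ ℕ) (hx : x ∈ (∏ j ∈ J, (o j).eval v).support) :
              (c + (∑ j ∈ Jᶜ, b j + x)).degree = N := by
            refine hU _ (hc _ ?_)
            rw [← Finset.prod_compl_mul_prod J]
            exact (NonnegCoeffs.prod fun x _ => hnn' x).add_mem_support_mul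
              (NonnegCoeffs.prod fun x _ => hnn' x)
              (NonnegCoeffs.sum_mem_support_prod (fun x _ => hnn' x) fun x _ =>
                hb x (Finset.mem_univ _)) hx
          have h1 := hsplit a' ha'
          have h2 := hsplit (∑ j ∈ J, b j) (NonnegCoeffs.sum_mem_support_prod
            (fun x _ => hnn' x) fun x _ => hb x (Finset.mem_univ _))
          simp only [map_add, map_sum] at h1 h2
          omega
        · intro m hm
          rw [hval, ← Finset.prod_compl_mul_prod J] at hm
          obtain ⟨y, hy, x, hx, rfl⟩ := exists_add_of_mem_support_mul hm
          refine ⟨x, hx, y, rfl, fun a' ha' => ?_⟩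
          rw [hval, ← Finset.prod_compl_mul_prod J]
          exact (NonnegCoeffs.prod fun x _ => hnn' x).add_mem_support_mul
            (NonnegCoeffs.prod fun x _ => hnn' x) hy ha'

/-- The monomials of a homogeneous polynomial computed by a monotone circuit are covered by
balanced rectangles, one for each gate. -/
theorem Circuit.IsMonotone.exists_rectangles {C : Circuit σ} (hC : C.IsMonotone)
    {f : MvPolynomial σ ℝ} (hf : C.Computes f) {N D : ℕ} (hN : ∀ m ∈ f.support, m.degree = N)
    (hD : 2 ≤ D) (hDN : D ≤ N) :
    ∃ Q : Fin C.size → Set (σ →₀ ℕ),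
      (∀ u, ∀ a ∈ Q u, D ≤ a.degree ∧ a.degree < 2 * D) ∧
      ∀ m ∈ f.support, ∃ u, ∃ a ∈ Q u, ∃ c, c + a = m ∧ ∀ a' ∈ Q u, c + a' ∈ f.support := by
  classical
  -- One factor set is fixed per gate, independently of the monomial; only the complementary part
  -- varies. Hence the number of rectangles is the number of gates.
  refine ⟨fun u => if h : ∃ Q, IsBalancedFactor D (C.value u) Q then h.choose else ∅, ?_, ?_⟩
  · intro u a ha
    dsimp only at ha
    split_ifs at ha with h
    · exact h.choose_spec.1 a ha
    · exact absurd ha (Set.notMem_empty a)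
  · intro m hm
    have hmD : D ≤ m.degree := (hN m hm).symm ▸ hDN
    obtain ⟨j, hj⟩ : ∃ j, C.output = .gate j := by
      have hm' := hm
      rw [← hf] at hm'
      cases ho : C.output with
      | var x =>
        rw [ho, Operand.eval, support_X, Finset.mem_singleton] at hm'
        rw [hm', Finsupp.degree_single] at hmD
        omega
      | const t =>
        rw [ho] at hm'
        have := support_monomial_subset hm'
        rw [Finset.mem_singleton] at this
        rw [this, map_zero] at hmD
        omega
      | gate j => exact ⟨j, rfl⟩
    have hfj : C.value j = f := by rw [← hf, hj]; rfl
    obtain ⟨u, a, c, hac, ha, hc, hQ⟩ := hC.exists_balancedFactor (U := f.support)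
      (by exact_mod_cast hN) hD j j.2 m 0
      (by rw [Fin.eta, hfj]; exact hm) (fun a' ha' => by
        rw [zero_add]
        rwa [Fin.eta, hfj] at ha') hmD
    obtain ⟨x, hx, y, hxy, hy⟩ := hQ.choose_spec.2 a ha
    refine ⟨u, ?_⟩
    dsimp only
    rw [dif_pos hQ]
    refine ⟨x, hx, c + y, ?_, fun a' ha' => ?_⟩
    · rw [add_assoc, hxy, hac, zero_add]
    · rw [add_assoc]
      exact hc _ (hy a' ha')

end Nonneg

/-! ### Rectangles of spanning trees -/

section Rectangles

open MvPolynomial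

variable {V : Type} [Fintype V]

/-- The number of factors of the monomial `m` in the row `v`. -/
def rowDegree (v : V) : (V × V →₀ ℕ) →+ ℕ where
  toFun m := ∑ j, m (v, j)
  map_zero' := by simp
  map_add' := by simp [Finset.sum_add_distrib]

theorem rowDegree_apply (v : V) (m : V × V →₀ ℕ) : rowDegree v m = ∑ j, m (v, j) := rfl

theorem degree_eq_sum_rowDegree (m : V × V →₀ ℕ) : m.degree = ∑ v, rowDegree v m := by
  simp only [rowDegree_apply]
  rw [Finsupp.degree_eq_sum, Fintype.sum_prod_type]

theorem apply_le_rowDegree (m : V × V →₀ ℕ) (v j : V) : m (v, j) ≤ rowDegree v m :=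
  Finset.single_le_sum (f := fun j => m (v, j)) (fun _ _ => Nat.zero_le _) (Finset.mem_univ j)

variable [DecidableEq V]

/-- The exponent vector of the tree `ν`. -/
noncomputable def treeMonomial (r : V) (ν : {v : V // v ≠ r} → V) : V × V →₀ ℕ :=
  ∑ i, Finsupp.single (i.1, ν i) 1

theorem degree_treeMonomial (r : V) (ν : {v : V // v ≠ r} → V) :
    (treeMonomial r ν).degree = Fintype.card {v : V // v ≠ r} := by
  simp [treeMonomial, map_sum, Finsupp.degree_single]

theorem treeMonomial_apply_coe (r : V) (ν : {v : V // v ≠ r} → V) (i : {v : V // v ≠ r}) (j : V) :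
    treeMonomial r ν (i.1, j) = if ν i = j then 1 else 0 := by
  rw [treeMonomial, Finsupp.finsetSum_apply, Finset.sum_eq_single i]
  · simp [Finsupp.single_apply]
  · intro b _ hb
    rw [Finsupp.single_apply, if_neg]
    intro h
    exact hb (Subtype.ext (Prod.ext_iff.mp h).1)
  · simp

theorem treeMonomial_apply_root (r : V) (ν : {v : V // v ≠ r} → V) (j : V) :
    treeMonomial r ν (r, j) = 0 := by
  rw [treeMonomial, Finsupp.finsetSum_apply, Finset.sum_eq_zero]
  intro i _
  rw [Finsupp.single_apply, if_neg]
  intro h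
  exact i.2 (Prod.ext_iff.mp h).1

theorem treeMonomial_injective (r : V) : Function.Injective (treeMonomial (V := V) r) := by
  intro ν ν' h
  funext i
  have h1 := treeMonomial_apply_coe r ν' i (ν i)
  rw [← h, treeMonomial_apply_coe, if_pos rfl] at h1
  by_contra hne
  rw [if_neg (Ne.symm hne)] at h1
  exact one_ne_zero h1

theorem mem_support_spanningTreePoly (G : SimpleGraph V) (r : V) (m : V × V →₀ ℕ) :
    m ∈ (spanningTreePoly G r).support ↔
      ∃ ν, IsDirectedSpanningTree G r ν ∧ treeMonomial r ν = m := by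
  have hmon (ν : {v : V // v ≠ r} → V) :
      ∏ i, (X (i.1, ν i) : MvPolynomial (V × V) ℝ) = monomial (treeMonomial r ν) 1 := by
    rw [treeMonomial, monomial_sum_one]
    rfl
  rw [spanningTreePoly, NonnegCoeffs.mem_support_sum]
  · simp only [hmon, Finset.mem_filter, Finset.mem_univ, true_and]
    refine exists_congr fun ν => and_congr_right fun _ => ?_
    rw [support_monomial, if_neg one_ne_zero, Finset.mem_singleton, eq_comm]
  · intro ν _
    rw [hmon]
    exact nonnegCoeffs_monomial _ zero_le_one

theorem vars_spanningTreePoly_subset (G : SimpleGraph V) [DecidableRel G.Adj] (r : V) :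
    (spanningTreePoly G r).vars ⊆ Finset.univ.filter fun e : V × V => G.Adj e.1 e.2 := by
  intro e he
  rw [mem_vars_iff_mem_support] at he
  obtain ⟨m, hm, he⟩ := he
  obtain ⟨ν, hν, rfl⟩ := (mem_support_spanningTreePoly G r m).mp hm
  rw [Finsupp.mem_support_iff] at he
  obtain ⟨i, j⟩ := e
  rw [Finset.mem_filter_univ]
  by_cases hi : i = r
  · subst hi
    exact absurd (treeMonomial_apply_root _ ν j) he
  · rw [treeMonomial_apply_coe r ν ⟨i, hi⟩] at he
    have h : ν ⟨i, hi⟩ = j := by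
      by_contra h
      exact he (if_neg h)
    exact h ▸ hν.2 ⟨i, hi⟩

theorem card_vars_spanningTreePoly_le (G : SimpleGraph V) [DecidableRel G.Adj] (r : V) {d : ℕ}
    (hG : G.IsRegularOfDegree d) :
    (spanningTreePoly G r).vars.card ≤ d * Fintype.card V := by
  refine (Finset.card_le_card (vars_spanningTreePoly_subset G r)).trans (le_of_eq ?_)
  have : (Finset.univ.filter fun e : V × V => G.Adj e.1 e.2) =
      ((Finset.univ : Finset V).sigma fun v => G.neighborFinset v).map
        (Equiv.sigmaEquivProd V V).toEmbedding := by
    ext ⟨i, j⟩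
    simp [Equiv.sigmaEquivProd]
  rw [this, Finset.card_map, Finset.card_sigma]
  simp only [SimpleGraph.card_neighborFinset_eq_degree, hG.degree_eq, Finset.sum_const,
    Finset.card_univ, smul_eq_mul, mul_comm]

theorem rowDegree_treeMonomial (r : V) (ν : {v : V // v ≠ r} → V) (v : V) :
    rowDegree v (treeMonomial r ν) = if v = r then 0 else 1 := by
  rw [rowDegree_apply]
  split_ifs with h
  · subst h
    exact Finset.sum_eq_zero fun j _ => treeMonomial_apply_root _ _ _
  · rw [Finset.sum_congr rfl fun j _ => treeMonomial_apply_coe r ν ⟨v, h⟩ j]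
    simp

theorem eq_of_treeMonomial_apply_pos {r : V} {ν : {v : V // v ≠ r} → V} {i : {v : V // v ≠ r}}
    {j : V} (h : 0 < treeMonomial r ν (i.1, j)) : ν i = j := by
  rw [treeMonomial_apply_coe] at h
  by_contra hne
  rw [if_neg hne] at h
  exact lt_irrefl _ h

/-- The trees in `F` can be recombined along the vertex set `S`. -/
def MixesAlong (G : SimpleGraph V) (r : V) (S : Finset V) (F : Set ({v : V // v ≠ r} → V)) : Prop :=
  ∀ ν ∈ F, ∀ ν' ∈ F, ∃ μ, IsDirectedSpanningTree G r μ ∧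
    ∀ i : {v : V // v ≠ r}, (i.1 ∈ S → μ i = ν i) ∧ (i.1 ∉ S → μ i = ν' i)

/-- A rectangle of monomials of the spanning tree polynomial consists of trees which can be
recombined along the set of the rows of one of its two sides. -/
theorem mixesAlong_of_rectangle (G : SimpleGraph V) (r : V) (Q K : Set (V × V →₀ ℕ))
    (h : ∀ c ∈ K, ∀ a ∈ Q, c + a ∈ (spanningTreePoly G r).support)
    {a₀ c₀ : V × V →₀ ℕ} (ha₀ : a₀ ∈ Q) (hc₀ : c₀ ∈ K) :
    ∃ S : Finset V, r ∉ S ∧ S.card = a₀.degree ∧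
      MixesAlong G r S {ν | ∃ c ∈ K, ∃ a ∈ Q, c + a = treeMonomial r ν} := by
  -- The two row degrees add up to the same value for every pair, so each is constant on its side of
  -- the rectangle.
  have hrow {c a : V × V →₀ ℕ} (hc : c ∈ K) (ha : a ∈ Q) (v : V) :
      rowDegree v c + rowDegree v a = if v = r then 0 else 1 := by
    obtain ⟨ν, -, hν⟩ := (mem_support_spanningTreePoly G r _).mp (h c hc a ha)
    rw [← map_add, ← hν, rowDegree_treeMonomial]
  have hrow₀ (v : V) := hrow hc₀ ha₀ v
  refine ⟨Finset.univ.filter fun v => rowDegree v a₀ = 1, ?_, ?_, ?_⟩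
  · have := hrow₀ r
    rw [if_pos rfl] at this
    simp only [Finset.mem_filter, Finset.mem_univ, true_and]
    omega
  · rw [Finset.card_filter, degree_eq_sum_rowDegree]
    refine Finset.sum_congr rfl fun v _ => ?_
    have := hrow₀ v
    split_ifs at this ⊢ <;> omega
  · rintro ν ⟨c, hc, a, ha, hν⟩ ν' ⟨c', hc', a', ha', hν'⟩
    -- On `S` the arcs of a tree come from its `Q`-part, off `S` from its `K`-part, so `c' + a` is
    -- the recombined tree.
    obtain ⟨μ, hμ, hμm⟩ := (mem_support_spanningTreePoly G r _).mp (h c' hc' a ha)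
    refine ⟨μ, hμ, fun i => ⟨fun hi => ?_, fun hi => ?_⟩⟩
    · refine eq_of_treeMonomial_apply_pos ?_
      simp only [Finset.mem_filter, Finset.mem_univ, true_and] at hi
      have h1 := hrow hc ha₀ i.1
      rw [if_neg i.2] at h1
      have h2 := apply_le_rowDegree c i.1 (ν i)
      have h3 := DFunLike.congr_fun hν (i.1, ν i)
      rw [treeMonomial_apply_coe, if_pos rfl, Finsupp.add_apply] at h3
      rw [hμm, Finsupp.add_apply]
      omega
    · refine eq_of_treeMonomial_apply_pos ?_
      simp only [Finset.mem_filter, Finset.mem_univ, true_and] at hi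
      have h0 := hrow₀ i.1
      have h1 := hrow hc₀ ha' i.1
      rw [if_neg i.2] at h0 h1
      have h2 := apply_le_rowDegree a' i.1 (ν' i)
      have h3 := DFunLike.congr_fun hν' (i.1, ν' i)
      rw [treeMonomial_apply_coe, if_pos rfl, Finsupp.add_apply] at h3
      rw [hμm, Finsupp.add_apply]
      omega

/-- A monotone circuit for the spanning tree polynomial covers the spanning trees by as many
balanced recombinable families as it has gates. -/
theorem Circuit.IsMonotone.exists_mixing_cover {G : SimpleGraph V} {r : V} {C : Circuit (V × V)}
    (hC : C.IsMonotone) (hf : C.Computes (spanningTreePoly G r)) {D : ℕ} (hD : 2 ≤ D)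
    (hDV : D + 1 ≤ Fintype.card V) :
    ∃ F : Fin C.size → Set ({v : V // v ≠ r} → V),
      (∀ ν, IsDirectedSpanningTree G r ν → ∃ u, ν ∈ F u) ∧
      ∀ u, (∀ ν ∈ F u, IsDirectedSpanningTree G r ν) ∧ ((F u).Nonempty →
        ∃ S : Finset V, r ∉ S ∧ D ≤ S.card ∧ S.card < 2 * D ∧ MixesAlong G r S (F u)) := by
  have hcard : Fintype.card {v : V // v ≠ r} = Fintype.card V - 1 := by
    rw [Fintype.card_subtype_compl, Fintype.card_subtype_eq]
  obtain ⟨Q, hQ, hcov⟩ := hC.exists_rectangles hf (N := Fintype.card V - 1) (D := D)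
    (fun m hm => by
      obtain ⟨ν, -, rfl⟩ := (mem_support_spanningTreePoly G r _).mp hm
      rw [degree_treeMonomial, hcard]) hD (by omega)
  set K : Fin C.size → Set (V × V →₀ ℕ) := fun u =>
    {c | ∀ a ∈ Q u, c + a ∈ (spanningTreePoly G r).support} with hK
  refine ⟨fun u => {ν | ∃ c ∈ K u, ∃ a ∈ Q u, c + a = treeMonomial r ν}, ?_, fun u => ⟨?_, ?_⟩⟩
  · intro ν hν
    obtain ⟨u, a, ha, c, hca, hc⟩ :=
      hcov _ ((mem_support_spanningTreePoly G r _).mpr ⟨ν, hν, rfl⟩)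
    exact ⟨u, c, hc, a, ha, hca⟩
  · rintro ν ⟨c, hc, a, ha, hca⟩
    obtain ⟨μ, hμ, h⟩ := (mem_support_spanningTreePoly G r _).mp (hc a ha)
    rw [hca] at h
    rwa [← treeMonomial_injective r h]
  · rintro ⟨ν, c, hc, a, ha, -⟩
    obtain ⟨S, h1, h2, h3⟩ := mixesAlong_of_rectangle G r (Q u) (K u)
      (fun c hc a ha => hc a ha) ha hc
    have := hQ u a ha
    exact ⟨S, h1, by omega, by omega, h3⟩

end Rectangles

/-! ### The second eigenvalue of a regular graph -/

section Spectral

variable {V : Type} [Fintype V]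

theorem sum_adjMatrix_row (G : SimpleGraph V) [DecidableRel G.Adj] {d : ℕ}
    (hG : G.IsRegularOfDegree d) (i : V) :
    ∑ j, G.adjMatrix ℝ i j = d := by
  have := G.adjMatrix_mulVec_const_apply_of_regular (α := ℝ) (a := 1) hG (v := i)
  simpa [Matrix.mulVec, dotProduct] using this

theorem adjMatrix_mulVec_one (G : SimpleGraph V) [DecidableRel G.Adj] {d : ℕ}
    (hG : G.IsRegularOfDegree d) :
    (G.adjMatrix ℝ).mulVec 1 = (d : ℝ) • 1 := by
  ext i
  simpa [Matrix.mulVec, dotProduct] using sum_adjMatrix_row G hG i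

variable [DecidableEq V]

theorem Matrix.IsHermitian.dotProduct_eq_sum_eigenvectorBasis {A : Matrix V V ℝ}
    (hA : A.IsHermitian) (x y : V → ℝ) :
    x ⬝ᵥ y = ∑ i, (⇑(hA.eigenvectorBasis i) ⬝ᵥ x) * (⇑(hA.eigenvectorBasis i) ⬝ᵥ y) := by
  have h := hA.eigenvectorBasis.sum_inner_mul_inner (WithLp.toLp 2 x) (WithLp.toLp 2 y)
  simp only [EuclideanSpace.inner_eq_star_dotProduct, star_trivial] at h
  rw [dotProduct_comm x y, ← h]
  refine Finset.sum_congr rfl fun i _ => ?_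
  rw [dotProduct_comm y]

theorem Matrix.IsHermitian.dotProduct_mulVec_eigenvectorBasis {A : Matrix V V ℝ}
    (hA : A.IsHermitian) (x : V → ℝ) (i : V) :
    ⇑(hA.eigenvectorBasis i) ⬝ᵥ A.mulVec x =
      hA.eigenvalues i * (⇑(hA.eigenvectorBasis i) ⬝ᵥ x) := by
  have hAT : A.transpose = A := by
    rw [← Matrix.conjTranspose_eq_transpose_of_trivial]; exact hA
  rw [Matrix.dotProduct_mulVec, ← Matrix.mulVec_transpose, hAT, hA.mulVec_eigenvectorBasis,
    smul_dotProduct, smul_eq_mul]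

theorem Matrix.IsHermitian.eigenvectorBasis_dotProduct_self {A : Matrix V V ℝ}
    (hA : A.IsHermitian) (i : V) :
    ⇑(hA.eigenvectorBasis i) ⬝ᵥ ⇑(hA.eigenvectorBasis i) = 1 := by
  have h := hA.eigenvectorBasis.orthonormal.1 i
  have h2 := real_inner_self_eq_norm_sq (hA.eigenvectorBasis i)
  rw [h, EuclideanSpace.inner_eq_star_dotProduct, star_trivial] at h2
  simpa using h2

/-- Parseval applied to each row: both sides are the squared Frobenius norm. -/
theorem Matrix.IsHermitian.sum_sq_eigenvalues {A : Matrix V V ℝ} (hA : A.IsHermitian) :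
    ∑ i, hA.eigenvalues i ^ 2 = ∑ k, ∑ l, A k l ^ 2 := by
  have h1 (i : V) : hA.eigenvalues i ^ 2 = ∑ k, (⇑(hA.eigenvectorBasis i) ⬝ᵥ A k) ^ 2 := by
    have h2 (k : V) : ⇑(hA.eigenvectorBasis i) ⬝ᵥ A k =
        hA.eigenvalues i * (hA.eigenvectorBasis i) k := by
      rw [dotProduct_comm]
      exact congrFun (hA.mulVec_eigenvectorBasis i) k
    simp_rw [h2, mul_pow]
    rw [← Finset.mul_sum]
    have h3 := hA.eigenvectorBasis_dotProduct_self i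
    simp only [dotProduct, ← sq] at h3
    rw [h3, mul_one]
  simp_rw [h1]
  rw [Finset.sum_comm]
  refine Finset.sum_congr rfl fun k _ => ?_
  have h4 := hA.dotProduct_eq_sum_eigenvectorBasis (A k) (A k)
  simp only [← sq] at h4
  rw [← h4]
  simp only [dotProduct, sq]

variable (G : SimpleGraph V) [DecidableRel G.Adj]

theorem eigenvalues_le_secondEigenvalue (hV : 1 < Fintype.card V) :
    ∃ i₀, ∀ i ≠ i₀, (adjMatrix_isHermitian G).eigenvalues i ≤ secondEigenvalue G hV := by
  refine ⟨Fintype.equivOfCardEq (Fintype.card_fin _) ⟨0, by omega⟩, fun i hi => ?_⟩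
  refine (adjMatrix_isHermitian G).eigenvalues₀_antitone ?_
  rw [Fin.le_def]
  by_contra h
  push Not at h
  refine hi ((Equiv.symm_apply_eq _).mp (Fin.ext ?_))
  exact Nat.lt_one_iff.mp h

/-- On vectors orthogonal to the all-ones vector the quadratic form of the adjacency matrix is
bounded by the second eigenvalue. -/
theorem dotProduct_adjMatrix_mulVec_le {d : ℕ} (hG : G.IsRegularOfDegree d)
    (hV : 1 < Fintype.card V) {μ : ℝ} (hμ : secondEigenvalue G hV ≤ μ) (hμd : μ < d)
    (x : V → ℝ) (hx : ∑ i, x i = 0) :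
    x ⬝ᵥ (G.adjMatrix ℝ).mulVec x ≤ μ * (x ⬝ᵥ x) := by
  have hA := adjMatrix_isHermitian G
  obtain ⟨i₀, hi₀⟩ := eigenvalues_le_secondEigenvalue G hV
  -- Eigenvectors other than number `i₀` have eigenvalue below `d`, hence are orthogonal to the
  -- all-ones vector. So the latter is a multiple of eigenvector `i₀`, and `x` is orthogonal to that
  -- one.
  have hone (i : V) (hi : i ≠ i₀) : ⇑(hA.eigenvectorBasis i) ⬝ᵥ (1 : V → ℝ) = 0 := by
    have h := hA.dotProduct_mulVec_eigenvectorBasis 1 i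
    rw [adjMatrix_mulVec_one G hG, dotProduct_smul, smul_eq_mul] at h
    have hlt : hA.eigenvalues i < d := ((hi₀ i hi).trans hμ).trans_lt hμd
    by_contra h0
    exact hlt.ne' (mul_right_cancel₀ h0 h)
  have hx₀ : ⇑(hA.eigenvectorBasis i₀) ⬝ᵥ x = 0 := by
    have h1 := hA.dotProduct_eq_sum_eigenvectorBasis x 1
    rw [Finset.sum_eq_single i₀ (fun i _ hi => by rw [hone i hi, mul_zero]) (by simp),
      dotProduct_one, hx] at h1
    have h2 := hA.dotProduct_eq_sum_eigenvectorBasis 1 1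
    rw [Finset.sum_eq_single i₀ (fun i _ hi => by rw [hone i hi, mul_zero]) (by simp),
      dotProduct_one] at h2
    have hcard : (0 : ℝ) < Fintype.card V := by exact_mod_cast (by omega)
    simp only [Pi.one_apply, Finset.sum_const, Finset.card_univ, nsmul_eq_mul, mul_one] at h2
    rcases mul_eq_zero.mp h1.symm with h | h
    · exact h
    · rw [h, mul_zero] at h2
      exact absurd h2 hcard.ne'
  rw [hA.dotProduct_eq_sum_eigenvectorBasis x (Matrix.mulVec _ x),
    hA.dotProduct_eq_sum_eigenvectorBasis x x, Finset.mul_sum]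
  refine Finset.sum_le_sum fun i _ => ?_
  rw [hA.dotProduct_mulVec_eigenvectorBasis]
  by_cases hi : i = i₀
  · rw [hi, hx₀]; simp
  · have := (hi₀ i hi).trans hμ
    nlinarith [mul_self_nonneg (⇑(hA.eigenvectorBasis i) ⬝ᵥ x)]

/-- Splitting off the mean of `x`. -/
theorem dotProduct_adjMatrix_mulVec_le_add {d : ℕ} (hG : G.IsRegularOfDegree d)
    (hV : 1 < Fintype.card V) {μ : ℝ} (hμ : secondEigenvalue G hV ≤ μ) (hμd : μ < d)
    (x : V → ℝ) :
    x ⬝ᵥ (G.adjMatrix ℝ).mulVec x ≤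
      μ * (x ⬝ᵥ x) + (d - μ) * (∑ i, x i) ^ 2 / Fintype.card V := by
  have hcard : (0 : ℝ) < Fintype.card V := by exact_mod_cast (by omega)
  set t : ℝ := (∑ i, x i) / Fintype.card V with ht
  have htn : ∑ i, x i = t * Fintype.card V := by rw [ht, div_mul_cancel₀ _ hcard.ne']
  have hone : (1 : V → ℝ) ⬝ᵥ 1 = Fintype.card V := by simp [dotProduct_one]
  have hx1 : x ⬝ᵥ 1 = t * Fintype.card V := by rw [dotProduct_one, htn]
  have h := dotProduct_adjMatrix_mulVec_le G hG hV hμ hμd (x - t • 1) (by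
    simp [Finset.sum_sub_distrib, htn, mul_comm])
  have hA1 : (1 : V → ℝ) ⬝ᵥ (G.adjMatrix ℝ).mulVec x = d * (t * Fintype.card V) := by
    have hT : (G.adjMatrix ℝ).transpose = G.adjMatrix ℝ := G.isSymm_adjMatrix
    rw [Matrix.dotProduct_mulVec, ← Matrix.mulVec_transpose, hT, adjMatrix_mulVec_one G hG,
      smul_dotProduct, dotProduct_comm, hx1, smul_eq_mul]
  rw [Matrix.mulVec_sub, Matrix.mulVec_smul, adjMatrix_mulVec_one G hG] at h
  simp only [sub_dotProduct, dotProduct_sub, smul_dotProduct, dotProduct_smul, smul_eq_mul,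
    hone, hx1, hA1, dotProduct_comm 1 x] at h
  have hsq : (d - μ) * (∑ i, x i) ^ 2 / Fintype.card V = (d - μ) * t ^ 2 * Fintype.card V := by
    rw [htn]; field_simp
  rw [hsq]
  linarith

/-- At the indicator of `S` the quadratic form counts the arcs inside `S`; the remaining ones out of
`d * S.card` cross the cut. -/
theorem sum_cut_ge {d : ℕ} (hG : G.IsRegularOfDegree d)
    (hV : 1 < Fintype.card V) {μ : ℝ} (hμ : secondEigenvalue G hV ≤ μ) (hμd : μ < d)
    (S : Finset V) :
    (d - μ) * (S.card * (Fintype.card V - S.card) / Fintype.card V) ≤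
      ∑ i ∈ S, ∑ j ∈ Sᶜ, G.adjMatrix ℝ i j := by
  have hcard : (0 : ℝ) < Fintype.card V := by exact_mod_cast (by omega)
  set x : V → ℝ := fun i => if i ∈ S then 1 else 0 with hx
  have hsum : ∑ i, x i = S.card := by simp [hx]
  have hxx : x ⬝ᵥ x = S.card := by simp [hx, dotProduct]
  have hxA : x ⬝ᵥ (G.adjMatrix ℝ).mulVec x = ∑ i ∈ S, ∑ j ∈ S, G.adjMatrix ℝ i j := by
    simp only [hx, dotProduct, Matrix.mulVec, ite_mul, one_mul, zero_mul, mul_ite, mul_one,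
      mul_zero, Finset.sum_ite_mem, Finset.univ_inter]
  have htot : ∑ i ∈ S, ∑ j ∈ S, G.adjMatrix ℝ i j + ∑ i ∈ S, ∑ j ∈ Sᶜ, G.adjMatrix ℝ i j =
      S.card * d := by
    rw [← Finset.sum_add_distrib]
    simp_rw [Finset.sum_add_sum_compl, sum_adjMatrix_row G hG]
    simp
  have h := dotProduct_adjMatrix_mulVec_le_add G hG hV hμ hμd x
  rw [hxA, hxx, hsum] at h
  have : (d - μ) * (S.card * (Fintype.card V - S.card) / Fintype.card V) =
      (d - μ) * S.card - (d - μ) * S.card ^ 2 / Fintype.card V := by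
    field_simp
  rw [this]
  linarith

end Spectral

/-! ### A lower bound for the number of spanning trees -/

section TreeCount

variable {V : Type} [Fintype V] [DecidableEq V]

/-- A rank one perturbation turns the Laplacian into a matrix whose determinant is a multiple of
that of the reduced Laplacian. -/
theorem det_laplacian_add_const {R : Type*} [CommRing R] (w : V → V → R) (r : V) (t : R)
    (hcol : ∀ j, ∑ i, w i j = ∑ k, w j k) :
    (Matrix.of fun i j => (if i = j then ∑ k, w i k else 0) - w i j + t).det =
      t * Fintype.card V ^ 2 * (reducedLaplacian r fun i j => w i.1 j).det := by
  set n : R := (Fintype.card V : R) with hn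
  set L : Matrix V V R := Matrix.of fun i j => (if i = j then ∑ k, w i k else 0) - w i j with hL
  set M : Matrix V V R := Matrix.of fun i j => (if i = j then ∑ k, w i k else 0) - w i j + t with hM
  -- Replacing row `r` by the sum of all rows: the Laplacian part cancels because in- and
  -- out-weights agree.
  have h1 : M.det = t * n * (M.updateRow r 1).det := by
    have h := M.det_updateRow_sum r 1
    rw [Pi.one_apply, one_smul] at h
    have hrow : ∑ k, (1 : V → R) k • M k = (t * n) • (1 : V → R) := by
      funext j
      refine (Finset.sum_apply j _ _).trans ?_
      simp [hM, Finset.sum_add_distrib, Finset.sum_sub_distrib, hcol, hn, mul_comm]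
    rw [← h, hrow, Matrix.det_updateRow_smul]
  have h2 : (M.updateRow r 1).det = (L.updateRow r 1).det := by
    refine Matrix.det_eq_of_forall_row_eq_smul_add_const (fun i => if i = r then 0 else t) r
      (if_pos rfl) fun i j => ?_
    by_cases hi : i = r
    · subst hi; simp
    · simp [hi, hM, hL]
  -- Adding all columns to column `r` leaves only the entry `n` in row `r`, since Laplacian rows sum
  -- to zero.
  have h3 : (L.updateRow r 1).det = ((L.updateRow r 1).updateCol r (Pi.single r n)).det := by
    have h := (L.updateRow r 1).det_updateCol_sum r 1
    rw [Pi.one_apply, one_smul] at h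
    rw [← h]
    congr 2
    ext i
    by_cases hi : i = r
    · subst hi; simp [hn]
    · simp [hi, hL, Finset.sum_sub_distrib]
  have hsing (N : Matrix {i // i = r} {i // i = r} R) [Fintype {i // i = r}]
      [DecidableEq {i // i = r}] : N.det = N ⟨r, rfl⟩ ⟨r, rfl⟩ :=
    Matrix.det_eq_elem_of_subsingleton N _
  have h4 : ((L.updateRow r 1).updateCol r (Pi.single r n)).det =
      n * (reducedLaplacian r fun i j => w i.1 j).det := by
    rw [Matrix.twoBlockTriangular_det _ (fun i => i = r)]
    · congr 1
      · rw [hsing]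
        simp [Matrix.toSquareBlockProp]
      · congr 1
        ext i j
        simp [Matrix.toSquareBlockProp, Matrix.updateRow_ne i.2, Matrix.updateCol_ne j.2, hL,
          reducedLaplacian, Subtype.ext_iff]
    · rintro i hi j rfl
      simp [hi]
  rw [h1, h2, h3, h4]
  ring

/-- It bounds a product of eigenvalues from below by their first two moments. The reason is `(1 + z)
* (1 - z + 2 * z ^ 2) = 1 + z ^ 2 * (1 + 2 * z) ≥ 1`. -/
theorem exp_sub_two_mul_sq_le_one_add {z : ℝ} (hz : -(1 / 2) ≤ z) :
    Real.exp (z - 2 * z ^ 2) ≤ 1 + z := by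
  have h1 : 0 < 1 + z := by linarith
  have h2 : (1 + z)⁻¹ ≤ Real.exp (-(z - 2 * z ^ 2)) := by
    refine le_trans ?_ (Real.add_one_le_exp _)
    rw [inv_le_iff_one_le_mul₀ h1]
    nlinarith [mul_nonneg (sq_nonneg z) (by linarith : 0 ≤ 1 + 2 * z)]
  rw [Real.exp_neg] at h2
  exact (inv_le_inv₀ h1 (Real.exp_pos _)).mp h2

theorem exp_le_prod_of_neg_half_le {ι : Type*} (S : Finset ι) (z : ι → ℝ)
    (hz : ∀ i ∈ S, -(1 / 2) ≤ z i) :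
    Real.exp (∑ i ∈ S, z i - 2 * ∑ i ∈ S, z i ^ 2) ≤ ∏ i ∈ S, (1 + z i) := by
  rw [Finset.mul_sum, ← Finset.sum_sub_distrib, Real.exp_sum]
  exact Finset.prod_le_prod (fun i _ => (Real.exp_pos _).le)
    fun i hi => exp_sub_two_mul_sq_le_one_add (hz i hi)

open Classical in
/-- The number of spanning trees of `G`. -/
noncomputable def treeCount (G : SimpleGraph V) (r : V) : ℕ :=
  (Finset.univ.filter fun ν : {v : V // v ≠ r} → V => IsDirectedSpanningTree G r ν).card

theorem treeCount_eq_det (G : SimpleGraph V) [DecidableRel G.Adj] (r : V) :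
    (treeCount G r : ℝ) = (reducedLaplacian r fun i j => G.adjMatrix ℝ i.1 j).det := by
  classical
  have h := congrArg (MvPolynomial.eval fun _ => (1 : ℝ)) (spanningTreePoly_eq_sum G r)
  rw [det_reducedLaplacian]
  simp only [spanningTreePoly, map_sum, map_prod, MvPolynomial.eval_X, Finset.prod_const_one,
    Finset.sum_const, nsmul_eq_mul, mul_one, apply_ite (MvPolynomial.eval fun _ => (1 : ℝ)),
    map_zero] at h
  rw [treeCount]
  convert h using 3
  exact SimpleGraph.adjMatrix_apply ..

/-- The shift `d / n` moves the eigenvalue 0 of the Laplacian to `d`, and the gap keeps all others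
at least `d / 2`. Trace and Frobenius norm show that the relative deviations from `d` have sum 1 and
square sum `n / d - 1`, so the determinant is close to `d ^ n`. -/
theorem treeCount_ge (G : SimpleGraph V) [DecidableRel G.Adj] (r : V) {d : ℕ} (hd : 0 < d)
    (hG : G.IsRegularOfDegree d) (hV : 1 < Fintype.card V)
    (hμ : secondEigenvalue G hV ≤ d / 2) :
    (d : ℝ) ^ Fintype.card V * Real.exp (-(2 * (Fintype.card V / d))) ≤
      d * Fintype.card V * treeCount G r := by
  have hcard : (0 : ℝ) < Fintype.card V := by exact_mod_cast (by omega)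
  have hd' : (0 : ℝ) < d := by exact_mod_cast hd
  set n : ℝ := (Fintype.card V : ℝ) with hn
  set A := G.adjMatrix ℝ with hA
  set M : Matrix V V ℝ := Matrix.of fun i j => (if i = j then ∑ k, A i k else 0) - A i j + d / n
    with hM
  have hrow (i : V) : ∑ j, A i j = d := sum_adjMatrix_row G hG i
  have hsymm (i j : V) : A i j = A j i := G.isSymm_adjMatrix.apply j i
  have hcol (j : V) : ∑ i, A i j = d := by simp_rw [hsymm _ j, hrow]
  have hMe (i j : V) : M i j = (if i = j then (d : ℝ) else 0) - A i j + d / n := by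
    rw [hM, Matrix.of_apply, hrow]
  have hdet : M.det = d * n * treeCount G r := by
    rw [hM, det_laplacian_add_const A r (d / n) fun j => by rw [hrow, hcol], ← hn,
      treeCount_eq_det, ← hA]
    field_simp
  have hMH : M.IsHermitian := by
    ext i j
    rw [Matrix.conjTranspose_apply, star_trivial, hMe, hMe, hsymm j i]
    simp only [eq_comm]
  have htrace : ∑ i, hMH.eigenvalues i = d * n + d := by
    have h := hMH.trace_eq_sum_eigenvalues
    simp only [RCLike.ofReal_real_eq_id, id] at h
    rw [← h, Matrix.trace]
    simp only [Matrix.diag_apply, hMe, if_true, hA, SimpleGraph.adjMatrix_apply,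
      SimpleGraph.irrefl, if_false, sub_zero, Finset.sum_const, Finset.card_univ, nsmul_eq_mul]
    rw [← hn]
    field_simp
  have hsq : ∑ i, hMH.eigenvalues i ^ 2 = d ^ 2 * n + n * d + d ^ 2 := by
    rw [hMH.sum_sq_eigenvalues]
    have hAA (i j : V) : A i j ^ 2 = A i j := by
      rw [hA, SimpleGraph.adjMatrix_apply]; split_ifs <;> norm_num
    have hAii (i : V) : A i i = 0 := by simp [hA]
    have hent (i j : V) : M i j ^ 2 = (if i = j then (d : ℝ) ^ 2 + 2 * d * (d / n) else 0)
        + A i j * (1 - 2 * (d / n)) + (d / n) ^ 2 := by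
      rw [hMe]
      split_ifs with h
      · subst h; rw [hAii]; ring
      · have := hAA i j
        ring_nf; rw [this]; ring
    simp_rw [hent, Finset.sum_add_distrib, ← Finset.sum_mul, hrow]
    simp only [Finset.sum_ite_eq, Finset.mem_univ, if_true, Finset.sum_const, Finset.card_univ,
      nsmul_eq_mul]
    rw [← hn]
    field_simp
    ring
  -- In the Rayleigh quotient the shift contributes `d / n` times the squared sum of `u`, twice what
  -- the mean part of `A` can take away.
  have hlow (i : V) : (d : ℝ) / 2 ≤ hMH.eigenvalues i := by
    set u : V → ℝ := ⇑(hMH.eigenvectorBasis i) with hu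
    have huu : u ⬝ᵥ u = 1 := hMH.eigenvectorBasis_dotProduct_self i
    have h1 : u ⬝ᵥ M.mulVec u = hMH.eigenvalues i := by
      rw [hMH.dotProduct_mulVec_eigenvectorBasis, huu, mul_one]
    have h2 : M.mulVec u = (d : ℝ) • u - A.mulVec u + (fun _ => d / n * ∑ j, u j) := by
      ext k
      simp only [Matrix.mulVec, dotProduct, hMe, add_mul, sub_mul, Finset.sum_add_distrib,
        Finset.sum_sub_distrib, ite_mul, zero_mul, Finset.sum_ite_eq, Finset.mem_univ, if_true,
        Pi.add_apply, Pi.sub_apply, Pi.smul_apply, smul_eq_mul, Finset.mul_sum]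
    have h3 : u ⬝ᵥ (fun _ => d / n * ∑ j, u j) = d / n * (∑ j, u j) ^ 2 := by
      rw [dotProduct, ← Finset.sum_mul]; ring
    have h4 := dotProduct_adjMatrix_mulVec_le_add G hG hV hμ (half_lt_self hd') u
    rw [h2, dotProduct_add, dotProduct_sub, dotProduct_smul, huu, h3, smul_eq_mul] at h1
    rw [huu, ← hn, ← hA] at h4
    have h5 : 0 ≤ d / n * (∑ j, u j) ^ 2 := by positivity
    have h6 : (d - d / 2 : ℝ) * (∑ j, u j) ^ 2 / n = d / n * (∑ j, u j) ^ 2 / 2 := by ring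
    rw [h6] at h4
    linarith
  have hprod := exp_le_prod_of_neg_half_le Finset.univ (fun i => hMH.eigenvalues i / d - 1)
    fun i _ => by
      have := hlow i
      rw [div_le_iff₀ two_pos] at this
      have : 1 / 2 ≤ hMH.eigenvalues i / d := by
        rw [le_div_iff₀ hd']; linarith
      linarith
  have hz1 : ∑ i, (hMH.eigenvalues i / d - 1) = 1 := by
    rw [Finset.sum_sub_distrib, ← Finset.sum_div, htrace]
    simp only [Finset.sum_const, Finset.card_univ, nsmul_eq_mul]
    rw [← hn]; field_simp; ring
  have hz2 : ∑ i, (hMH.eigenvalues i / d - 1) ^ 2 = n / d - 1 := by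
    have (i : V) : (hMH.eigenvalues i / d - 1) ^ 2 =
        hMH.eigenvalues i ^ 2 / d ^ 2 - 2 * (hMH.eigenvalues i / d - 1) - 1 := by ring
    simp_rw [this, Finset.sum_sub_distrib, ← Finset.mul_sum, ← Finset.sum_div, hsq]
    rw [hz1]
    simp only [Finset.sum_const, Finset.card_univ, nsmul_eq_mul]
    rw [← hn]; field_simp; ring
  rw [hz1, hz2] at hprod
  have hMdet : M.det = d ^ Fintype.card V * ∏ i, (1 + (hMH.eigenvalues i / d - 1)) := by
    rw [hMH.det_eq_prod_eigenvalues, ← Finset.card_univ, ← Finset.prod_const,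
      ← Finset.prod_mul_distrib]
    refine Finset.prod_congr rfl fun i _ => ?_
    simp only [RCLike.ofReal_real_eq_id, id]
    field_simp
    ring
  rw [← hdet, hMdet]
  refine mul_le_mul_of_nonneg_left (le_trans (Real.exp_le_exp.mpr ?_) hprod) (by positivity)
  linarith

end TreeCount

/-! ### The number of trees in a recombinable family -/

section MixingBound

variable {V : Type} [DecidableEq V]

/-- The orbit would stay in `{s, t}` and never meet the root. -/
theorem IsDirectedSpanningTree.not_two_cycle {G : SimpleGraph V} {r : V}
    {μ : {v : V // v ≠ r} → V} (hμ : IsDirectedSpanningTree G r μ) (s t : {v : V // v ≠ r})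
    (hst : μ s = t) (hts : μ t = s) : False := by
  obtain ⟨k, hk⟩ := hμ.1 s
  have h (k : ℕ) : (extendRoot r μ)^[k] s.1 = s ∨ (extendRoot r μ)^[k] s.1 = t := by
    induction k with
    | zero => exact Or.inl rfl
    | succ k ih =>
      rw [Function.iterate_succ_apply']
      rcases ih with h | h
      · right; rw [h, extendRoot_coe, hst]
      · left; rw [h, extendRoot_coe, hts]
  rcases h k with h | h
  · exact s.2 (h.symm.trans hk)
  · exact t.2 (h.symm.trans hk)

variable [Fintype V]

open Classical in
/-- The indicator of the arcs of `G` which no tree of the family `F` uses. -/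
noncomputable def unusedArc (G : SimpleGraph V) (r : V) (F : Set ({v : V // v ≠ r} → V))
    (i j : V) : ℝ :=
  if h : i = r then 0 else if G.Adj i j ∧ ∀ ν ∈ F, ν ⟨i, h⟩ ≠ j then 1 else 0

theorem unusedArc_nonneg (G : SimpleGraph V) (r : V) (F : Set ({v : V // v ≠ r} → V))
    (i j : V) : 0 ≤ unusedArc G r F i j := by
  unfold unusedArc
  split_ifs <;> norm_num

/-- If both orientations of a cut edge were used, mixing the two trees would give a 2-cycle. Edges
at the root are subtracted because the root has no out-arc; there are at most `d` of them. -/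
theorem adjMatrix_sub_le_unusedArc (G : SimpleGraph V) [DecidableRel G.Adj] {r : V}
    {S : Finset V} (hr : r ∉ S) {F : Set ({v : V // v ≠ r} → V)} (hF : MixesAlong G r S F)
    {i j : V} (hi : i ∈ S) (hj : j ∉ S) :
    G.adjMatrix ℝ i j - (if j = r then G.adjMatrix ℝ i r else 0) ≤
      unusedArc G r F i j + unusedArc G r F j i := by
  have h0 := unusedArc_nonneg G r F i j
  have h0' := unusedArc_nonneg G r F j i
  by_cases hjr : j = r
  · have h : G.adjMatrix ℝ i j = G.adjMatrix ℝ i r := by rw [hjr]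
    rw [if_pos hjr, h, sub_self]
    exact add_nonneg h0 h0'
  rw [if_neg hjr, sub_zero, SimpleGraph.adjMatrix_apply]
  split_ifs with hadj
  swap
  · exact add_nonneg h0 h0'
  have hir : i ≠ r := fun h => hr (h ▸ hi)
  by_cases h1 : ∀ ν ∈ F, ν ⟨i, hir⟩ ≠ j
  · have : unusedArc G r F i j = 1 := by
      rw [unusedArc, dif_neg hir, if_pos ⟨hadj, h1⟩]
    linarith
  by_cases h2 : ∀ ν ∈ F, ν ⟨j, hjr⟩ ≠ i
  · have : unusedArc G r F j i = 1 := by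
      rw [unusedArc, dif_neg hjr, if_pos ⟨hadj.symm, h2⟩]
    linarith
  push Not at h1 h2
  obtain ⟨ν, hν, hνi⟩ := h1
  obtain ⟨ν', hν', hνj⟩ := h2
  obtain ⟨μ, hμ, hmix⟩ := hF ν hν ν' hν'
  exact (hμ.not_two_cycle ⟨i, hir⟩ ⟨j, hjr⟩ (((hmix _).1 hi).trans hνi)
    (((hmix _).2 hj).trans hνj)).elim

theorem sum_cut_le_sum_unusedArc (G : SimpleGraph V) [DecidableRel G.Adj] {d : ℕ}
    (hG : G.IsRegularOfDegree d) {r : V}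
    {S : Finset V} (hr : r ∉ S) {F : Set ({v : V // v ≠ r} → V)} (hF : MixesAlong G r S F) :
    ∑ i ∈ S, ∑ j ∈ Sᶜ, G.adjMatrix ℝ i j - d ≤ ∑ i, ∑ j, unusedArc G r F i j := by
  have h1 : ∑ i ∈ S, ∑ j ∈ Sᶜ, (G.adjMatrix ℝ i j - (if j = r then G.adjMatrix ℝ i r else 0)) ≤
      ∑ i ∈ S, ∑ j ∈ Sᶜ, (unusedArc G r F i j + unusedArc G r F j i) :=
    Finset.sum_le_sum fun i hi => Finset.sum_le_sum fun j hj =>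
      adjMatrix_sub_le_unusedArc G hr hF hi (Finset.mem_compl.mp hj)
  simp only [Finset.sum_sub_distrib, Finset.sum_add_distrib, Finset.sum_ite_eq',
    Finset.mem_compl, hr, not_false_eq_true, if_true] at h1
  have h2 : ∑ i ∈ S, G.adjMatrix ℝ i r ≤ d := by
    rw [← sum_adjMatrix_row G hG r]
    refine (Finset.sum_le_univ_sum_of_nonneg fun i => ?_).trans (le_of_eq ?_)
    · rw [SimpleGraph.adjMatrix_apply]; split_ifs <;> norm_num
    · exact Finset.sum_congr rfl fun i _ => G.isSymm_adjMatrix.apply r i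
  have h3 : ∑ i ∈ S, ∑ j ∈ Sᶜ, unusedArc G r F i j ≤ ∑ i ∈ S, ∑ j, unusedArc G r F i j :=
    Finset.sum_le_sum fun i _ =>
      Finset.sum_le_univ_sum_of_nonneg fun j => unusedArc_nonneg G r F i j
  have h4 : ∑ i ∈ S, ∑ j ∈ Sᶜ, unusedArc G r F j i ≤ ∑ i ∈ Sᶜ, ∑ j, unusedArc G r F i j := by
    rw [Finset.sum_comm]
    exact Finset.sum_le_sum fun i _ =>
      Finset.sum_le_univ_sum_of_nonneg fun j => unusedArc_nonneg G r F i j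
  have h5 := Finset.sum_add_sum_compl S fun i => ∑ j, unusedArc G r F i j
  linarith

open Classical in
theorem card_outNeighbors_eq (G : SimpleGraph V) [DecidableRel G.Adj] {d : ℕ}
    (hG : G.IsRegularOfDegree d) {r : V} {F : Set ({v : V // v ≠ r} → V)}
    (hF : ∀ ν ∈ F, IsDirectedSpanningTree G r ν) (i : {v : V // v ≠ r}) :
    ((Finset.univ.filter fun j => ∃ ν ∈ F, ν i = j).card : ℝ) =
      d - ∑ j, unusedArc G r F i j := by
  rw [← sum_adjMatrix_row G hG i, ← Finset.sum_sub_distrib, Finset.card_filter, Nat.cast_sum]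
  refine Finset.sum_congr rfl fun j _ => ?_
  rw [unusedArc, dif_neg i.2, SimpleGraph.adjMatrix_apply]
  by_cases hadj : G.Adj i.1 j
  · by_cases h : ∃ ν ∈ F, ν i = j
    · have h' : ¬ ∀ ν ∈ F, ν i ≠ j := by push Not; exact h
      simp [hadj, h, h']
    · have h' : ∀ ν ∈ F, ν i ≠ j := by push Not at h; exact h
      rw [if_neg h, if_pos hadj, if_pos ⟨hadj, h'⟩]
      norm_num
  · have h : ¬ ∃ ν ∈ F, ν i = j := by
      rintro ⟨ν, hν, rfl⟩
      exact hadj ((hF ν hν).2 i)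
    simp [hadj, h]

/-- The family lies in the product of its sets of used out-neighbors. Each lost arc costs a factor
`exp (-1 / d)` through `1 - x ≤ exp (-x)`, and the up to `d` edges at the root cost the extra `exp
1`. -/
theorem ncard_le_of_mixesAlong (G : SimpleGraph V) [DecidableRel G.Adj] {d : ℕ} (hd : 0 < d)
    (hG : G.IsRegularOfDegree d) {r : V} {S : Finset V} (hr : r ∉ S)
    {F : Set ({v : V // v ≠ r} → V)} (hF : ∀ ν ∈ F, IsDirectedSpanningTree G r ν)
    (hmix : MixesAlong G r S F) :
    (F.ncard : ℝ) ≤ d ^ (Fintype.card V - 1) *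
      Real.exp (1 - (∑ i ∈ S, ∑ j ∈ Sᶜ, G.adjMatrix ℝ i j) / d) := by
  classical
  have hd' : (0 : ℝ) < d := by exact_mod_cast hd
  have hcard : Fintype.card {v : V // v ≠ r} = Fintype.card V - 1 := by
    rw [Fintype.card_subtype_compl, Fintype.card_subtype_eq]
  set out : {v : V // v ≠ r} → Finset V := fun i => Finset.univ.filter fun j => ∃ ν ∈ F, ν i = j
    with hout
  have hsub : F ⊆ Fintype.piFinset out := by
    intro ν hν
    rw [Finset.mem_coe, Fintype.mem_piFinset]
    intro i
    rw [hout, Finset.mem_filter_univ]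
    exact ⟨ν, hν, rfl⟩
  have h1 : F.ncard ≤ ∏ i, (out i).card := by
    rw [← Fintype.card_piFinset, ← Set.ncard_coe_finset]
    exact Set.ncard_le_ncard hsub (Finset.finite_toSet _)
  have h2 (i : {v : V // v ≠ r}) :
      ((out i).card : ℝ) ≤ d * Real.exp (-(∑ j, unusedArc G r F i j) / d) := by
    rw [hout, card_outNeighbors_eq G hG hF i]
    have h := Real.add_one_le_exp (-(∑ j, unusedArc G r F i j) / d)
    calc (d : ℝ) - ∑ j, unusedArc G r F i j = d * (-(∑ j, unusedArc G r F i j) / d + 1) := by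
          field_simp; ring
      _ ≤ _ := mul_le_mul_of_nonneg_left h hd'.le
  have h3 : ∑ i : {v : V // v ≠ r}, ∑ j, unusedArc G r F i j = ∑ i, ∑ j, unusedArc G r F i j := by
    have h := Finset.sum_subtype_of_mem (s := Finset.univ.erase r) (p := fun v => v ≠ r)
      (fun i => ∑ j, unusedArc G r F i j) fun i hi => Finset.ne_of_mem_erase hi
    have hu : (Finset.univ.erase r).subtype (fun v => v ≠ r) = Finset.univ := by
      ext i
      simp [i.2]
    rw [hu] at h
    rw [h, ← Finset.sum_erase_add _ _ (Finset.mem_univ r)]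
    simp [unusedArc]
  calc (F.ncard : ℝ) ≤ ∏ i, ((out i).card : ℝ) := by exact_mod_cast h1
    _ ≤ ∏ i : {v : V // v ≠ r}, (d * Real.exp (-(∑ j, unusedArc G r F i j) / d)) :=
        Finset.prod_le_prod (fun i _ => Nat.cast_nonneg _) fun i _ => h2 i
    _ = d ^ (Fintype.card V - 1) * Real.exp (-(∑ i, ∑ j, unusedArc G r F i j) / d) := by
        rw [Finset.prod_mul_distrib, Finset.prod_const, Finset.card_univ, hcard, ← Real.exp_sum,
          ← Finset.sum_div, Finset.sum_neg_distrib, h3]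
    _ ≤ _ := by
        refine mul_le_mul_of_nonneg_left (Real.exp_le_exp.mpr ?_) (by positivity)
        have h4 := sum_cut_le_sum_unusedArc G hG hr hmix
        rw [div_le_iff₀ hd', sub_mul, div_mul_cancel₀ _ hd'.ne', one_mul]
        linarith

end MixingBound

/-! ### The exponential lower bound for monotone circuits -/

section LowerBound

variable {V : Type} [Fintype V] [DecidableEq V]

/-- Balanced cuts of a regular graph with spectral gap at least `d / 2` are large. -/
theorem balanced_cut_ge (G : SimpleGraph V) [DecidableRel G.Adj] {d : ℕ}
    (hG : G.IsRegularOfDegree d) (hd : 0 < d) (hV : 1 < Fintype.card V)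
    (hμ : secondEigenvalue G hV ≤ d / 2) (S : Finset V)
    (h1 : (Fintype.card V : ℝ) / 4 ≤ S.card) (h2 : (S.card : ℝ) ≤ 3 * Fintype.card V / 4) :
    3 * (Fintype.card V : ℝ) / 32 ≤ (∑ i ∈ S, ∑ j ∈ Sᶜ, G.adjMatrix ℝ i j) / d := by
  have hcard : (0 : ℝ) < Fintype.card V := by exact_mod_cast (by omega)
  have hd' : (0 : ℝ) < d := by exact_mod_cast hd
  have h := sum_cut_ge G hG hV hμ (half_lt_self hd') S
  rw [le_div_iff₀ hd']
  refine le_trans ?_ h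
  have hS : 3 * (Fintype.card V : ℝ) / 16 ≤
      S.card * (Fintype.card V - S.card) / Fintype.card V := by
    rw [le_div_iff₀ hcard]
    nlinarith
  nlinarith

theorem treeCount_le_size_mul (G : SimpleGraph V) [DecidableRel G.Adj] (r : V) {d : ℕ}
    (hG : G.IsRegularOfDegree d) (hd : 0 < d) (hV : 16 ≤ Fintype.card V)
    (hμ : secondEigenvalue G (by omega) ≤ d / 2) (C : Circuit (V × V)) (hC : C.IsMonotone)
    (hf : C.Computes (spanningTreePoly G r)) :
    (treeCount G r : ℝ) ≤ C.size *
      (d ^ (Fintype.card V - 1) * Real.exp (1 - 3 * (Fintype.card V : ℝ) / 32)) := by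
  classical
  set n := Fintype.card V with hn
  -- `D` is `n / 4` rounded up, so that `S.card` lies between `n / 4` and `3 * n / 4` despite the
  -- rounding.
  obtain ⟨F, hcov, hF⟩ := hC.exists_mixing_cover hf (D := (n + 3) / 4) (by omega) (by omega)
  have hbound (u : Fin C.size) :
      ((F u).ncard : ℝ) ≤ d ^ (n - 1) * Real.exp (1 - 3 * (n : ℝ) / 32) := by
    obtain ⟨htree, hmix⟩ := hF u
    rcases (F u).eq_empty_or_nonempty with h | h
    · rw [h, Set.ncard_empty, Nat.cast_zero]
      positivity
    · obtain ⟨S, hr, h1, h2, h3⟩ := hmix h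
      refine (ncard_le_of_mixesAlong G hd hG hr htree h3).trans
        (mul_le_mul_of_nonneg_left (Real.exp_le_exp.mpr ?_) (by positivity))
      have h4 : n ≤ 4 * S.card := by omega
      have h5 : 4 * S.card ≤ 3 * n := by omega
      have h4' : (n : ℝ) ≤ 4 * S.card := by exact_mod_cast h4
      have h5' : (4 : ℝ) * S.card ≤ 3 * n := by exact_mod_cast h5
      have := balanced_cut_ge G hG hd (by omega) hμ S (by linarith) (by linarith)
      linarith
  have hle : treeCount G r ≤ ∑ u, (F u).ncard := by
    have hsub : (Finset.univ.filter fun ν => IsDirectedSpanningTree G r ν) ⊆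
        Finset.univ.biUnion fun u => (F u).toFinset := by
      intro ν hν
      obtain ⟨u, hu⟩ := hcov ν (Finset.mem_filter.mp hν).2
      exact Finset.mem_biUnion.mpr ⟨u, Finset.mem_univ _, Set.mem_toFinset.mpr hu⟩
    rw [treeCount]
    refine ((Finset.card_le_card hsub).trans Finset.card_biUnion_le).trans (le_of_eq ?_)
    exact Finset.sum_congr rfl fun u _ => (Set.ncard_eq_toFinset_card' _).symm
  calc (treeCount G r : ℝ) ≤ ∑ u, ((F u).ncard : ℝ) := by exact_mod_cast hle
    _ ≤ ∑ _u : Fin C.size, d ^ (n - 1) * Real.exp (1 - 3 * (n : ℝ) / 32) :=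
        Finset.sum_le_sum fun u _ => hbound u
    _ = _ := by rw [Finset.sum_const, Finset.card_univ, Fintype.card_fin, nsmul_eq_mul]

theorem size_ge (G : SimpleGraph V) [DecidableRel G.Adj] (r : V) {d : ℕ}
    (hG : G.IsRegularOfDegree d) (hd : 40000 ≤ d) (hV : 1 < Fintype.card V)
    (hμ : secondEigenvalue G hV ≤ d / 2) (C : Circuit (V × V)) (hC : C.IsMonotone)
    (hf : C.Computes (spanningTreePoly G r)) :
    (2 : ℝ) ^ ((1 / 32 : ℝ) * Fintype.card V) ≤ C.size := by
  have hdV : d < Fintype.card V := by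
    rw [← hG.degree_eq r]
    exact G.degree_lt_card_verts r
  have hd0 : (40000 : ℝ) ≤ d := by exact_mod_cast hd
  have hd' : (0 : ℝ) < d := by linarith
  have h1 := treeCount_le_size_mul G r hG (by omega) (by omega) hμ C hC hf
  have h2 := treeCount_ge G r (by omega) hG hV hμ
  set n := Fintype.card V with hn
  have hdn : (d : ℝ) < n := by exact_mod_cast hdV
  have hn0 : (0 : ℝ) < n := by linarith
  have h3 : (d : ℝ) ^ n * Real.exp (-(2 * (n / d))) ≤
      d ^ n * (n * C.size * Real.exp (1 - 3 * (n : ℝ) / 32)) := by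
    refine h2.trans ((mul_le_mul_of_nonneg_left h1 (by positivity)).trans (le_of_eq ?_))
    obtain ⟨k, hk⟩ := Nat.exists_eq_add_of_lt (show 0 < n by omega)
    rw [hk]
    simp only [zero_add, Nat.add_sub_cancel]
    ring
  have h4 := le_of_mul_le_mul_left h3 (by positivity)
  have h5 : (n : ℝ) / d ≤ n / 40000 := by
    apply div_le_div_of_nonneg_left hn0.le (by norm_num) hd0
  -- The threshold 40000 is `200 ^ 2`: since `n > d ≥ 40000`, the term `(n / 200) ^ 2` alone exceeds
  -- `n`.
  have h6 : (n : ℝ) ≤ Real.exp (n / 100) := by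
    have h7 : (1 + (n : ℝ) / 200) ^ 2 ≤ Real.exp (n / 100) := by
      rw [show (n : ℝ) / 100 = n / 200 + n / 200 by ring, Real.exp_add, ← sq]
      exact pow_le_pow_left₀ (by positivity) (by linarith [Real.add_one_le_exp ((n : ℝ) / 200)]) 2
    nlinarith
  have h8 : Real.exp (-(2 * (n / d))) ≤
      C.size * Real.exp (n / 100 + (1 - 3 * (n : ℝ) / 32)) := by
    refine h4.trans ?_
    rw [Real.exp_add, mul_comm (n : ℝ), mul_assoc]
    gcongr
  have h9 : Real.exp (n / 32) ≤ C.size := by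
    have h10 : Real.exp (-(2 * (n / d)) - (n / 100 + (1 - 3 * (n : ℝ) / 32))) ≤ C.size := by
      rw [Real.exp_sub, div_le_iff₀ (Real.exp_pos _)]
      exact h8
    refine le_trans (Real.exp_le_exp.mpr ?_) h10
    -- The exponent `3 * n / 32` loses `n / 100` to the factor `n`, at most `n / 20000` to the tree
    -- count, and 1; more than `n / 32` remains.
    linarith
  refine le_trans ?_ h9
  rw [Real.rpow_def_of_pos two_pos]
  refine Real.exp_le_exp.mpr ?_
  have : Real.log 2 ≤ 1 := by linarith [Real.log_two_lt_d9]
  nlinarith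

theorem exists_degree_rpow_le_half {ε : ℝ} (hε : 0 < ε) :
    ∃ d₀ : ℕ, ∀ d : ℕ, d₀ ≤ d → (d : ℝ) ^ (1 - ε) ≤ d / 2 := by
  have h := (tendsto_rpow_atTop hε).comp tendsto_natCast_atTop_atTop
  obtain ⟨d₀, hd₀⟩ := Filter.eventually_atTop.mp (h.eventually_ge_atTop 2)
  refine ⟨max d₀ 1, fun d hd => ?_⟩
  have h1 : 2 ≤ (d : ℝ) ^ ε := hd₀ d (le_trans (le_max_left _ _) hd)
  have hd' : (0 : ℝ) < d := by exact_mod_cast (lt_of_lt_of_le one_pos ((le_max_right _ _).trans hd))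
  rw [Real.rpow_sub hd', Real.rpow_one]
  exact div_le_div_of_nonneg_left hd'.le two_pos h1

end LowerBound

theorem theorem1 :
    (∃ c : ℝ, 0 < c ∧ ∀ ε : ℝ, 0 < ε → ∃ d₀ : ℕ, ∀ d : ℕ, d₀ ≤ d →
      ∀ (n : ℕ) (hn : 1 < Fintype.card (Fin n)) (G : SimpleGraph (Fin n)) [DecidableRel G.Adj]
        (r : Fin n),
        G.IsRegularOfDegree d →
        secondEigenvalue G hn ≤ (d : ℝ) ^ (1 - ε) →
        (spanningTreePoly G r).vars.card ≤ d * n ∧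
        ∀ C : Circuit (Fin n × Fin n), C.IsMonotone → C.Computes (spanningTreePoly G r) →
          (2 : ℝ) ^ (c * (n : ℝ)) ≤ (C.size : ℝ)) ∧
    (∀ (G : ∀ n : ℕ, SimpleGraph (Fin (n + 1))) (r : ∀ n : ℕ, Fin (n + 1)),
      InVP (fun n => spanningTreePoly (G n) (r n))) := by
  refine ⟨⟨1 / 32, by norm_num, fun ε hε => ?_⟩, inVP_spanningTreePoly⟩
  obtain ⟨d₀, hd₀⟩ := exists_degree_rpow_le_half hε
  refine ⟨max d₀ 40000, fun d hd n hn G _ r hG hμ => ⟨?_, fun C hC hf => ?_⟩⟩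
  · simpa using card_vars_spanningTreePoly_le G r hG
  · have h := size_ge G r hG ((le_max_right _ _).trans hd) hn
      (hμ.trans (hd₀ d ((le_max_left _ _).trans hd))) C hC hf
    rwa [Fintype.card_fin] at h
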